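/- **Theorem 2.** Let $\mathcal M=(S,A,\imath,G,R,T)$ be a finite MDP with initial state $\imath$, goal states $G\subseteq S$, rewards $R\colon S\to\mathbb R$ and transition probabilities $T(s,a,s')$ for the enabled actions $a\in \mathrm{Act}(s)$, where $\mathrm{Act}(s)=\emptyset$ exactly for $s\in G$. Let $\mathrm{Post}(s,a)=\{s' : T(s,a,s')>0\}$. Assume that $\mathcal M$ is contracting: under every memoryless randomized strategy, the runs from $\imath$ reach $G$ with probability $1$. Let $0<p_{min}\le \min\{T(s,a,s') : T(s,a,s')>0\}$, $\delta\in(0,1)$, $N\ge 1$, let $\underline V_0,\overline V_0\colon S\to\mathbb R$ be fixed initial value functions (for instance, safe a-priori bounds), and let $\epsilon_k\in(0,1]$ be exploration parameters with $\sum_k \epsilon_k^{|S|}=\infty$ (for instance, a constant $\epsilon_k=\epsilon$). Consider the algorithm IMDP_RL with $\epsilon$-greedy lower-confidence-bound (LCB) sampling. It works in episodes $k=1,2,\dots$. In each episode it samples $N$ runs of $\mathcal M$ from $\imath$; a run ends when it enters $G$ or has $|S|$ transitions. In a state that still has enabled actions never sampled before, one of these is chosen (by any rule); otherwise an action is drawn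 from the current sampling strategy, which is uniform on $\mathrm{Act}(s)$ in the first episode. After episode $k$, let $\#(s,a,s')$ be the number of times the transition $(s,a,s')$ has been sampled so far, $\#(s,a)=\sum_{s'\in \mathrm{Post}(s,a)}\#(s,a,s')$, and let $N_t$ be the number of triples $(s,a,s')$ with $s'\in \mathrm{Post}(s,a)$ and $|\mathrm{Post}(s,a)|>1$. Then: * For $s'\in \mathrm{Post}(s,a)$ the interval of $(s,a,s')$ is $[p_{min},1]$ if $\#(s,a)=0$, and otherwise it has the end points $$\underline T=\max\Big(\tfrac{\#(s,a,s')}{\#(s,a)}-c,\ p_{min}\Big),\qquad \overline T=\min\Big(\tfrac{\#(s,a,s')}{\#(s,a)}+c,\ 1\Big),\qquad c=\sqrt{\frac{\log(\delta/(2N_t))}{-2\,\#(s,a)}}$$ (with $c=0$ if $N_t=0$, i.e. if all transitions are deterministic); for $s'\notin \mathrm{Post}(s,a)$ it is $[0,0]$. * Given $V\colon S\to\mathbb R$, the minimizing (resp. maximizing) transitions $T^-_V(s,a,\cdot)$ (resp. $T^+_V(s,a,\cdot)$) start from the lower end points and pass through the states in increasing (resp. decreasing) order of $V$, raising the probability of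 each of them until the total mass is $1$ or the upper end point is reached. * $\underline V$ results from $\underline V_0$ by $k\cdot|S|$ steps $V(s):=R(s)+\max_{a\in \mathrm{Act}(s)}\sum_{s'}V(s')\,T^-_V(s,a,s')$ for $s\notin G$ and $V(s):=R(s)$ for $s\in G$, and $\overline V$ from $\overline V_0$ in the same way with $T^+_V$. Put $\underline Q(s,a)=R(s)+\sum_{s'}\underline V(s')T^-_{\underline V}(s,a,s')$ and $\overline Q(s,a)=R(s)+\sum_{s'}\overline V(s')T^+_{\overline V}(s,a,s')$. * The next sampling strategy gives every $a\in \mathrm{Act}(s)$ probability $\epsilon_k/|\mathrm{Act}(s)|$, and in addition $1-\epsilon_k$ to one action that maximizes $\underline Q(s,\cdot)$ (ties broken by any rule). Let $\underline V_K,\overline V_K,\underline Q_K,\overline Q_K$ be the results after $K$ episodes. Then the Bellman equations $V^*(s)=R(s)$ for $s\in G$, $V^*(s)=R(s)+\max_{a\in \mathrm{Act}(s)}\sum_{s'}V^*(s')T(s,a,s')$ for $s\notin G$, have a unique solution $V^*$ on the set of states reachable from $\imath$, and with probability $1$: 1. $\lim_{K\to\infty}\underline V_K(s)=V^*(s)=\lim_{K\to\infty}\overline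 V_K(s)$ for every $s$ reachable from $\imath$; 2. for all sufficiently large $K$, every pessimistically optimal strategy (choosing only actions in $\arg\max_{a\in \mathrm{Act}(s)}\underline Q_K(s,a)$ in each $s\notin G$) and every optimistically optimal strategy (the same with $\overline Q_K$) is optimal: from every $s$ reachable from $\imath$ its expected accumulated reward until the goal, the reward of the goal state included, equals $V^*(s)$ and is maximal among all memoryless randomized strategies. -/

import Mathlib

open scoped ENNReal

universe u v

/-- A finite Markov decision process. `act s` is the set of enabled actions of `s`; it is empty
exactly in the goal states. The transition function is extended by `0` to disabled actions. -/
structure MDP (S : Type u) (A : Type v) [Fintype S] where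
  init : S
  goal : Finset S
  reward : S → ℝ
  act : S → Finset A
  trans : S → A → S → ℝ
  trans_nonneg : ∀ s a s', 0 ≤ trans s a s'
  trans_sum : ∀ s, ∀ a ∈ act s, ∑ s', trans s a s' = 1
  trans_disabled : ∀ s a s', a ∉ act s → trans s a s' = 0
  act_goal : ∀ s ∈ goal, act s = ∅
  act_nonempty : ∀ s, s ∉ goal → (act s).Nonempty

/-- Memoryless randomized strategies. Goal states have no enabled action, so nothing is chosen
there. -/
structure MDP.Strategy {S : Type u} {A : Type v} [Fintype S] [Fintype A] (M : MDP S A) where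
  prob : S → A → ℝ
  nonneg : ∀ s a, 0 ≤ prob s a
  disabled : ∀ s a, a ∉ M.act s → prob s a = 0
  sum_eq_one : ∀ s, s ∉ M.goal → ∑ a, prob s a = 1

namespace MDP

variable {S : Type u} {A : Type v} [Fintype S] [Fintype A] [DecidableEq S] [DecidableEq A]

/-- The successors of `s` via `a`. -/
noncomputable def post (M : MDP S A) (s : S) (a : A) : Finset S :=
  Finset.univ.filter fun s' => 0 < M.trans s a s'

/-- `s` is reachable from the initial state. -/
def Reachable (M : MDP S A) (s : S) : Prop :=
  Relation.ReflTransGen (fun s₁ s₂ => ∃ a ∈ M.act s₁, 0 < M.trans s₁ a s₂) M.init s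

/-! ### Runs, contracting MDPs, expected rewards

A run `s a₀ s₁ a₁ … sₙ` from `s` is represented by the list `[(a₀, s₁), (a₁, s₂), …]`. -/

/-- The probability of a run from a given state under a strategy. -/
def runProb (M : MDP S A) (σ : M.Strategy) : S → List (A × S) → ℝ
  | _, [] => 1
  | s, (a, s') :: π => σ.prob s a * M.trans s a s' * runProb M σ s' π

/-- The run visits a goal state at its end, and only there. -/
def EndsInGoal (M : MDP S A) : S → List (A × S) → Prop
  | s, [] => s ∈ M.goal
  | s, (_, s') :: π => s ∉ M.goal ∧ EndsInGoal M s' π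

/-- The reward accumulated along a run, including the reward of its last state. -/
def runReward (M : MDP S A) : S → List (A × S) → ℝ
  | s, [] => M.reward s
  | s, (_, s') :: π => M.reward s + runReward M s' π

open scoped Classical in
/-- The probability of a run if it ends in a goal state, and `0` for all other runs. -/
noncomputable def goalProb (M : MDP S A) (σ : M.Strategy) (s : S) (π : List (A × S)) : ℝ :=
  if M.EndsInGoal s π then M.runProb σ s π else 0

/-- Under every strategy, the runs from the initial state reach a goal state almost surely. -/
def Contracting (M : MDP S A) : Prop :=
  ∀ σ : M.Strategy, HasSum (fun π => M.goalProb σ M.init π) 1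

/-- `v` is the expected accumulated reward of the runs from `s` to the goal under `σ`. -/
def HasExpectedReward (M : MDP S A) (σ : M.Strategy) (s : S) (v : ℝ) : Prop :=
  HasSum (fun π => M.goalProb σ s π * M.runReward s π) v

/-- `σ` maximizes the expected accumulated reward from `s` among all strategies. -/
def IsOptimalAt (M : MDP S A) (σ : M.Strategy) (s : S) : Prop :=
  ∃ v, M.HasExpectedReward σ s v ∧
    ∀ (σ' : M.Strategy) (v' : ℝ), M.HasExpectedReward σ' s v' → v' ≤ v

/-! ### Bellman equations -/

/-- `max_{a ∈ Act(s)} Q(s,a)`, and `R(s)` in states without enabled actions. -/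
noncomputable def maxQ (M : MDP S A) (Q : S → A → ℝ) (s : S) : ℝ :=
  if h : (M.act s).Nonempty then (M.act s).sup' h (Q s) else M.reward s

/-- `V` solves the Bellman equations on the states that are reachable from the initial state. -/
def SolvesBellman (M : MDP S A) (V : S → ℝ) : Prop :=
  ∀ s, M.Reachable s →
    V s = M.maxQ (fun s a => M.reward s + ∑ s', V s' * M.trans s a s') s

/-- The enabled actions that maximize `Q s`. -/
noncomputable def argmax (M : MDP S A) (Q : S → A → ℝ) (s : S) : Finset A :=
  (M.act s).filter fun a => ∀ b ∈ M.act s, Q s b ≤ Q s a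

/-- `σ(s) = argmax_a Q(s,a)`, with ties resolved in any way. -/
def IsGreedy (M : MDP S A) (Q : S → A → ℝ) (σ : M.Strategy) : Prop :=
  ∀ s, s ∉ M.goal → ∀ a, 0 < σ.prob s a → a ∈ M.argmax Q s

end MDP

/-! ### Interval transition functions and interval value iteration -/

/-- An interval transition function `(s,a,s') ↦ [lo s a s', hi s a s']`. -/
structure IntervalTrans (S : Type u) (A : Type v) where
  lo : S → A → S → ℝ
  hi : S → A → S → ℝ

/-- Start with the lower bounds `l` and go through the given list of states; in each of them, raise
the value until the total mass is `1` or the upper bound `h` is reached, whichever comes first. -/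
noncomputable def greedyFill {S : Type u} [Fintype S] [DecidableEq S] (l h : S → ℝ)
    (order : List S) : S → ℝ :=
  order.foldl
    (fun t s' => Function.update t s' (max (t s') (min (h s') (t s' + (1 - ∑ u, t u))))) l

namespace IntervalTrans

variable {S : Type u} {A : Type v} [Fintype S] [DecidableEq S]

/-- Minimizing transitions: the free mass goes to the states with the smallest values first. -/
noncomputable def minTrans (U : IntervalTrans S A) (V : S → ℝ) (s : S) (a : A) : S → ℝ :=
  greedyFill (U.lo s a) (U.hi s a)
    ((Finset.univ : Finset S).toList.mergeSort fun x y => decide (V x ≤ V y))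

/-- Maximizing transitions: the free mass goes to the states with the largest values first. -/
noncomputable def maxTrans (U : IntervalTrans S A) (V : S → ℝ) (s : S) (a : A) : S → ℝ :=
  greedyFill (U.lo s a) (U.hi s a)
    ((Finset.univ : Finset S).toList.mergeSort fun x y => decide (V y ≤ V x))

end IntervalTrans

namespace MDP

variable {S : Type u} {A : Type v} [Fintype S] [Fintype A] [DecidableEq S] [DecidableEq A]

/-- The pessimistic quality for the value estimate `V`. -/
noncomputable def qLo (M : MDP S A) (U : IntervalTrans S A) (V : S → ℝ) (s : S) (a : A) : ℝ :=
  M.reward s + ∑ s', V s' * U.minTrans V s a s'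

/-- The optimistic quality for the value estimate `V`. -/
noncomputable def qHi (M : MDP S A) (U : IntervalTrans S A) (V : S → ℝ) (s : S) (a : A) : ℝ :=
  M.reward s + ∑ s', V s' * U.maxTrans V s a s'

/-- `n` steps of pessimistic interval value iteration, started in `V`. -/
noncomputable def iterLo (M : MDP S A) (U : IntervalTrans S A) (n : ℕ) (V : S → ℝ) : S → ℝ :=
  (fun W => M.maxQ (M.qLo U W))^[n] V

/-- `n` steps of optimistic interval value iteration, started in `V`. -/
noncomputable def iterHi (M : MDP S A) (U : IntervalTrans S A) (n : ℕ) (V : S → ℝ) : S → ℝ :=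
  (fun W => M.maxQ (M.qHi U W))^[n] V

end MDP

/-! ### The learning algorithm

Every sampled run gets `|S|` time slots, so that an episode of `N` runs takes `N * |S|` slots.
In each slot either one transition `(s, a, s')` is sampled (`some (s, a, s')`), or, when the current
run has already reached a goal state, nothing happens (`none`). A history is the list of the slots
so far, the oldest first. -/

/-- What happens in one time slot. -/
abbrev Slot (S : Type u) (A : Type v) := Option (S × A × S)

instance Slot.instMeasurableSpace {S : Type u} {A : Type v} : MeasurableSpace (Slot S A) := ⊤

instance Slot.instDiscreteMeasurableSpace {S : Type u} {A : Type v} :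
    DiscreteMeasurableSpace (Slot S A) := ⟨fun _ => trivial⟩

/-- The parameters of the algorithm, and the choices that it leaves open. -/
structure RLParams {S : Type u} {A : Type v} [Fintype S] [Fintype A] (M : MDP S A) where
  /-- lower bound on the positive transition probabilities -/
  pmin : ℝ
  pmin_pos : 0 < pmin
  pmin_le : ∀ s a s', 0 < M.trans s a s' → pmin ≤ M.trans s a s'
  /-- error tolerance -/
  δ : ℝ
  δ_pos : 0 < δ
  δ_lt_one : δ < 1
  /-- number of runs per episode -/
  N : ℕ
  N_pos : 0 < N
  /-- `ε k` is the exploration probability of the sampling strategy computed after `k` episodes -/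
  ε : ℕ → ℝ
  ε_pos : ∀ k, 0 < ε k
  ε_le_one : ∀ k, ε k ≤ 1
  /-- initial lower bounds for the value iteration -/
  initLo : S → ℝ
  /-- initial upper bounds for the value iteration -/
  initHi : S → ℝ
  /-- selects one of the maximizing actions, possibly depending on the history -/
  pickBest : List (Slot S A) → S → Finset A → A
  pickBest_mem : ∀ l s F, F.Nonempty → pickBest l s F ∈ F
  /-- selects one of the actions not sampled yet, possibly randomized and depending on the
  history -/
  pickNew : List (Slot S A) → S → Finset A → PMF A
  pickNew_mem : ∀ l s F, F.Nonempty → ∀ a ∈ (pickNew l s F).support, a ∈ F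

namespace RLParams

variable {S : Type u} {A : Type v} [Fintype S] [Fintype A] [DecidableEq S] [DecidableEq A]
  {M : MDP S A}

/-- `#(s,a,s')`: how often the transition was sampled. -/
def count (_P : RLParams M) (l : List (Slot S A)) (s : S) (a : A) (s' : S) : ℕ :=
  l.count (some (s, a, s'))

/-- `#(s,a)`. -/
noncomputable def visits (P : RLParams M) (l : List (Slot S A)) (s : S) (a : A) : ℕ :=
  ∑ s' ∈ M.post s a, P.count l s a s'

/-- The number of probabilistic transitions. -/
noncomputable def numTrans (_P : RLParams M) : ℕ :=
  (Finset.univ.filter fun x : S × A × S =>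
    x.2.2 ∈ M.post x.1 x.2.1 ∧ 1 < (M.post x.1 x.2.1).card).card

/-- The radius `c(s,a,η)` of the confidence interval, with `η = δ / numTrans`. -/
noncomputable def radius (P : RLParams M) (l : List (Slot S A)) (s : S) (a : A) : ℝ :=
  √(Real.log ((P.δ / P.numTrans) / 2) / (-2 * P.visits l s a))

/-- The interval transition function learned from a history. It is `[pmin, 1]` for successors under
an action not sampled yet, and `[0, 0]` for non-successors. -/
noncomputable def intervals (P : RLParams M) (l : List (Slot S A)) : IntervalTrans S A where
  lo s a s' :=
    if s' ∉ M.post s a then 0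
    else if P.visits l s a = 0 then P.pmin
    else max ((P.count l s a s' : ℝ) / P.visits l s a - P.radius l s a) P.pmin
  hi s a s' :=
    if s' ∉ M.post s a then 0
    else if P.visits l s a = 0 then 1
    else min ((P.count l s a s' : ℝ) / P.visits l s a + P.radius l s a) 1

/-- The lower value bounds computed from the history `l` of the first `k` episodes. -/
noncomputable def lowerBound (P : RLParams M) (k : ℕ) (l : List (Slot S A)) : S → ℝ :=
  M.iterLo (P.intervals l) (k * Fintype.card S) P.initLo

/-- The upper value bounds computed from the history `l` of the first `k` episodes. -/
noncomputable def upperBound (P : RLParams M) (k : ℕ) (l : List (Slot S A)) : S → ℝ :=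
  M.iterHi (P.intervals l) (k * Fintype.card S) P.initHi

/-- The lower quality bounds computed from the history `l` of the first `k` episodes. -/
noncomputable def lowerQ (P : RLParams M) (k : ℕ) (l : List (Slot S A)) : S → A → ℝ :=
  M.qLo (P.intervals l) (P.lowerBound k l)

/-- The upper quality bounds computed from the history `l` of the first `k` episodes. -/
noncomputable def upperQ (P : RLParams M) (k : ℕ) (l : List (Slot S A)) : S → A → ℝ :=
  M.qHi (P.intervals l) (P.upperBound k l)

/-- The `ε`-greedy lower confidence bound strategy computed from the history `l` of the first `k`
episodes. -/
noncomputable def lcb (P : RLParams M) (k : ℕ) (l : List (Slot S A)) (s : S) (a : A) : ℝ :=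
  if a ∈ M.act s then
    P.ε k / (M.act s).card +
      if a = P.pickBest l s (M.argmax (P.lowerQ k l) s) then 1 - P.ε k else 0
  else 0

/-- The number of time slots of an episode. -/
def epLen (P : RLParams M) : ℕ := P.N * Fintype.card S

/-- The sampling strategy in force after the history `l`: uniform in the first episode; later the
`ε`-greedy LCB strategy computed from the `k` completed episodes. -/
noncomputable def sampling (P : RLParams M) (l : List (Slot S A)) (s : S) (a : A) : ℝ :=
  let k := l.length / P.epLen
  if k = 0 then (if a ∈ M.act s then 1 / (M.act s).card else 0)
  else P.lcb k (l.take (k * P.epLen)) s a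

/-- The enabled actions of `s` that were not sampled yet. -/
noncomputable def unsampled (P : RLParams M) (l : List (Slot S A)) (s : S) : Finset A :=
  (M.act s).filter fun a => P.visits l s a = 0

/-- The probability with which `a` is chosen in `s` after the history `l`: an action not sampled yet
if there is one, and otherwise an action drawn from the sampling strategy. -/
noncomputable def actionProb (P : RLParams M) (l : List (Slot S A)) (s : S) (a : A) : ℝ :=
  if (P.unsampled l s).Nonempty then (P.pickNew l s (P.unsampled l s) a).toReal
  else P.sampling l s a

/-- The state in which the next action is to be chosen; `none` if the current run has already
reached a goal state. Runs start in the initial state and have at most `|S|` transitions. -/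
def current (_P : RLParams M) (l : List (Slot S A)) : Option S :=
  (if l.length % Fintype.card S = 0 then some M.init
    else l.getLast?.join.map fun x => x.2.2).filter fun s => decide (s ∉ M.goal)

/-- The probability that `x` happens in the slot after the history `l`. -/
noncomputable def slotProb (P : RLParams M) (l : List (Slot S A)) (x : Slot S A) : ℝ :=
  match P.current l, x with
  | none, none => 1
  | none, some _ => 0
  | some _, none => 0
  | some s, some (s₁, a, s₂) => if s₁ = s then P.actionProb l s a * M.trans s a s₂ else 0


theorem sum_sampling (P : RLParams M) (l : List (Slot S A)) (s : S) (hs : s ∉ M.goal) :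
    ∑ a, P.sampling l s a = 1 := by
  have hne := M.act_nonempty s hs
  have hc : ((M.act s).card : ℝ) ≠ 0 := by exact_mod_cast hne.card_pos.ne'
  unfold sampling
  simp only
  split_ifs with hk
  · rw [Finset.sum_ite_mem, Finset.univ_inter, Finset.sum_const, nsmul_eq_mul]
    field_simp
  · unfold lcb
    set k := l.length / P.epLen
    set l' := l.take (k * P.epLen)
    have hF : (M.argmax (P.lowerQ k l') s).Nonempty := by
      obtain ⟨a, ha, hmax⟩ := (M.act s).exists_max_image (P.lowerQ k l' s) hne
      exact ⟨a, Finset.mem_filter.2 ⟨ha, hmax⟩⟩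
    have hb : P.pickBest l' s (M.argmax (P.lowerQ k l') s) ∈ M.act s :=
      (Finset.mem_filter.1 (P.pickBest_mem l' s _ hF)).1
    rw [Finset.sum_ite_mem, Finset.univ_inter, Finset.sum_add_distrib, Finset.sum_const,
      nsmul_eq_mul, Finset.sum_ite_eq' (M.act s)]
    rw [if_pos hb]
    field_simp
    ring

theorem sampling_nonneg (P : RLParams M) (l : List (Slot S A)) (s : S) (a : A) :
    0 ≤ P.sampling l s a := by
  unfold sampling
  simp only
  split_ifs
  · positivity
  · exact le_rfl
  · unfold lcb
    have h1 := (P.ε_pos (l.length / P.epLen)).le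
    have h2 := P.ε_le_one (l.length / P.epLen)
    split_ifs
    · have : 0 ≤ 1 - P.ε (l.length / P.epLen) := by linarith
      positivity
    · positivity
    · exact le_rfl

theorem sampling_disabled (P : RLParams M) (l : List (Slot S A)) (s : S) (a : A)
    (ha : a ∉ M.act s) : P.sampling l s a = 0 := by
  simp [sampling, lcb, ha]

theorem actionProb_nonneg (P : RLParams M) (l : List (Slot S A)) (s : S) (a : A) :
    0 ≤ P.actionProb l s a := by
  unfold actionProb
  split_ifs
  · exact ENNReal.toReal_nonneg
  · exact P.sampling_nonneg l s a

theorem actionProb_disabled (P : RLParams M) (l : List (Slot S A)) (s : S) (a : A)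
    (ha : a ∉ M.act s) : P.actionProb l s a = 0 := by
  unfold actionProb
  split_ifs with h
  · rw [(PMF.apply_eq_zero_iff _ _).2, ENNReal.toReal_zero]
    exact fun hmem => ha (Finset.mem_filter.1 (P.pickNew_mem l s _ h a hmem)).1
  · exact P.sampling_disabled l s a ha

theorem sum_actionProb (P : RLParams M) (l : List (Slot S A)) (s : S) (hs : s ∉ M.goal) :
    ∑ a, P.actionProb l s a = 1 := by
  unfold actionProb
  split_ifs
  · rw [← ENNReal.toReal_sum fun a _ => PMF.apply_ne_top _ _]
    have := (P.pickNew l s (P.unsampled l s)).tsum_coe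
    rw [tsum_fintype] at this
    rw [this, ENNReal.toReal_one]
  · exact P.sum_sampling l s hs

theorem slotProb_nonneg (P : RLParams M) (l : List (Slot S A)) (x : Slot S A) :
    0 ≤ P.slotProb l x := by
  unfold slotProb
  split
  · exact zero_le_one
  · exact le_rfl
  · exact le_rfl
  · split_ifs
    · exact mul_nonneg (P.actionProb_nonneg _ _ _) (M.trans_nonneg _ _ _)
    · exact le_rfl

theorem sum_slotProb (P : RLParams M) (l : List (Slot S A)) :
    ∑ x, P.slotProb l x = 1 := by
  rw [Fintype.sum_option]
  rcases hcur : P.current l with _ | s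
  · simp [slotProb, hcur]
  · have hs : s ∉ M.goal := by
      have := (Option.filter_eq_some_iff.1 hcur).2
      simpa using this
    have h1 : ∀ a, ∑ s₂, P.actionProb l s a * M.trans s a s₂ = P.actionProb l s a := by
      intro a
      rw [← Finset.mul_sum]
      by_cases ha : a ∈ M.act s
      · rw [M.trans_sum s a ha, mul_one]
      · rw [P.actionProb_disabled l s a ha, zero_mul]
    simp only [slotProb, hcur, zero_add, Fintype.sum_prod_type]
    rw [Finset.sum_eq_single s]
    · simp [h1, P.sum_actionProb l s hs]
    · intro b _ hb
      simp [hb]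
    · simp

/-- The law of the slot after the history `l`. -/
noncomputable def slotLaw (P : RLParams M) (l : List (Slot S A)) : PMF (Slot S A) :=
  PMF.ofFintype (fun x => ENNReal.ofReal (P.slotProb l x)) (by
    rw [← ENNReal.ofReal_sum_of_nonneg fun x _ => P.slotProb_nonneg l x, P.sum_slotProb l,
      ENNReal.ofReal_one])

/-- The law of slot `n + 1` given the slots `0, …, n`. -/
noncomputable def slotKernel (P : RLParams M) (n : ℕ) :
    ProbabilityTheory.Kernel (∀ _ : Finset.Iic n, Slot S A) (Slot S A) where
  toFun x := (P.slotLaw (List.ofFn fun i : Fin (n + 1) =>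
    x ⟨i, Finset.mem_Iic.2 (Nat.le_of_lt_succ i.2)⟩)).toMeasure
  measurable' := Measurable.of_discrete

instance (P : RLParams M) (n : ℕ) : ProbabilityTheory.IsMarkovKernel (P.slotKernel n) :=
  ⟨fun _ => (inferInstance : MeasureTheory.IsProbabilityMeasure (PMF.toMeasure _))⟩

/-- The law of the infinite sequence of time slots of the algorithm. -/
noncomputable def law (P : RLParams M) : MeasureTheory.Measure (ℕ → Slot S A) :=
  ProbabilityTheory.Kernel.trajMeasure (X := fun _ => Slot S A) (P.slotLaw []).toMeasure
    P.slotKernel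

/-- The history of the first `k` episodes. -/
def history (P : RLParams M) (ω : ℕ → Slot S A) (k : ℕ) : List (Slot S A) :=
  List.ofFn fun i : Fin (k * P.epLen) => ω i

end RLParams

set_option linter.unusedSectionVars false

namespace MDP

variable {S : Type u} {A : Type v} [Fintype S] [Fintype A] [DecidableEq S] [DecidableEq A]
  (M : MDP S A)

theorem mem_act_of_trans_pos {s : S} {a : A} {s' : S} (h : 0 < M.trans s a s') : a ∈ M.act s := by
  by_contra ha
  exact h.ne' (M.trans_disabled s a s' ha)

theorem trans_le_one (s : S) (a : A) (s' : S) : M.trans s a s' ≤ 1 := by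
  by_cases ha : a ∈ M.act s
  · rw [← M.trans_sum s a ha]
    exact Finset.single_le_sum (fun u _ => M.trans_nonneg s a u) (Finset.mem_univ s')
  · rw [M.trans_disabled s a s' ha]
    exact zero_le_one

theorem mem_post {s : S} {a : A} {s' : S} : s' ∈ M.post s a ↔ 0 < M.trans s a s' := by
  simp [MDP.post]

theorem trans_eq_zero {s : S} {a : A} {s' : S} (h : s' ∉ M.post s a) : M.trans s a s' = 0 :=
  le_antisymm (not_lt.1 fun h' => h (M.mem_post.2 h')) (M.trans_nonneg _ _ _)

theorem notMem_goal_of_mem_act {s : S} {a : A} (h : a ∈ M.act s) : s ∉ M.goal := fun hs => by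
  simp [M.act_goal s hs] at h

end MDP

/-! ### The history process -/

namespace RLParams

open MeasureTheory ProbabilityTheory Filter

variable {S : Type u} {A : Type v} [Fintype S] [Fintype A] [DecidableEq S] [DecidableEq A]
  {M : MDP S A}

/-- The history of the first `n` time slots. -/
def hist (ω : ℕ → Slot S A) (n : ℕ) : List (Slot S A) :=
  List.ofFn fun i : Fin n => ω i

theorem hist_succ (ω : ℕ → Slot S A) (n : ℕ) : hist ω (n + 1) = hist ω n ++ [ω n] :=
  List.ofFn_succ_last

@[simp]
theorem length_hist (ω : ℕ → Slot S A) (n : ℕ) : (hist ω n).length = n := List.length_ofFn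

instance (P : RLParams M) : IsProbabilityMeasure P.law := by
  unfold law; infer_instance

theorem stronglyMeasurable_hist (f : List (Slot S A) → ℝ) {m n : ℕ} (h : m ≤ n) :
    StronglyMeasurable[(Filtration.piLE (X := fun _ : ℕ => Slot S A)) n]
      (fun ω => f (hist ω (m + 1))) := by
  refine StronglyMeasurable.mono ?_ ((Filtration.piLE (X := fun _ : ℕ => Slot S A)).mono h)
  rw [Filtration.piLE_eq_comap_frestrictLe]
  have : Measurable (fun x : (∀ _ : Finset.Iic m, Slot S A) => f (List.ofFn fun i : Fin (m + 1) =>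
      x ⟨i, Finset.mem_Iic.2 (Nat.le_of_lt_succ i.2)⟩)) := Measurable.of_discrete
  exact (this.comp (comap_measurable _)).stronglyMeasurable

theorem integrable_hist (P : RLParams M) (f : List (Slot S A) → ℝ) (n : ℕ) :
    Integrable (fun ω => f (hist ω (n + 1))) P.law := by
  have h : Integrable (fun x : (∀ _ : Finset.Iic n, Slot S A) => f (List.ofFn fun i : Fin (n + 1) =>
      x ⟨i, Finset.mem_Iic.2 (Nat.le_of_lt_succ i.2)⟩))
      (P.law.map (Preorder.frestrictLe (π := fun _ => Slot S A) n)) := by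
    have := Measure.isFiniteMeasure_map P.law (Preorder.frestrictLe (π := fun _ => Slot S A) n)
    exact Integrable.of_finite
  exact h.comp_measurable (Preorder.measurable_frestrictLe n)

/-- The expectation of `f` after the next slot. -/
noncomputable def next (P : RLParams M) (f : List (Slot S A) → ℝ) (l : List (Slot S A)) : ℝ :=
  ∑ x, P.slotProb l x * f (l ++ [x])

theorem condExp_hist (P : RLParams M) (f : List (Slot S A) → ℝ) (n : ℕ) :
    P.law[fun ω => f (hist ω (n + 2)) | Filtration.piLE n] =ᵐ[P.law]
      fun ω => P.next f (hist ω (n + 1)) := by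
  rw [Filtration.piLE_eq_comap_frestrictLe]
  have hm := Preorder.measurable_frestrictLe (X := fun _ : ℕ => Slot S A) n
  let F : (∀ _ : Finset.Iic n, Slot S A) × Slot S A → ℝ := fun p =>
    f ((List.ofFn fun i : Fin (n + 1) =>
      p.1 ⟨i, Finset.mem_Iic.2 (Nat.le_of_lt_succ i.2)⟩) ++ [p.2])
  have hF : ∀ ω : ℕ → Slot S A, f (hist ω (n + 2)) =
      F (Preorder.frestrictLe (π := fun _ => Slot S A) n ω, ω (n + 1)) := fun ω => by
    rw [hist_succ]; rfl
  have h1 := condExp_prod_ae_eq_integral_condDistrib (μ := P.law) (f := F)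
    (X := Preorder.frestrictLe (π := fun _ => Slot S A) n) (Y := fun ω => ω (n + 1)) hm
    (measurable_pi_apply _).aemeasurable (Measurable.of_discrete).stronglyMeasurable
    ((P.integrable_hist f (n + 1)).congr (Eventually.of_forall hF))
  have h2 := ae_of_ae_map hm.aemeasurable
    (Kernel.condDistrib_trajMeasure (X := fun _ => Slot S A) (κ := P.slotKernel)
      (μ₀ := (P.slotLaw []).toMeasure) (a := n))
  simp only [hF]
  refine h1.trans ?_
  filter_upwards [h2] with ω hω
  change ∫ y, _ ∂(condDistrib _ _ (Kernel.trajMeasure _ _) _) = _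
  rw [hω]
  change ∫ y, _ ∂((P.slotLaw _).toMeasure) = _
  rw [PMF.integral_eq_sum]
  refine Finset.sum_congr rfl fun x _ => ?_
  rw [slotLaw, PMF.ofFintype_apply, ENNReal.toReal_ofReal (P.slotProb_nonneg _ _), smul_eq_mul]
  rfl

theorem condExp_hist_add (P : RLParams M) (f : List (Slot S A) → ℝ) (n m : ℕ) :
    P.law[fun ω => f (hist ω (n + m + 1)) | Filtration.piLE n] =ᵐ[P.law]
      fun ω => (P.next^[m] f) (hist ω (n + 1)) := by
  induction m generalizing f with
  | zero =>
    rw [condExp_of_stronglyMeasurable ((Filtration.piLE (X := fun _ : ℕ => Slot S A)).le n)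
      (stronglyMeasurable_hist f le_rfl) (P.integrable_hist f n)]
    rfl
  | succ m ih =>
    refine ((condExp_condExp_of_le ((Filtration.piLE (X := fun _ : ℕ => Slot S A)).mono
      (Nat.le_add_right n m)) ((Filtration.piLE (X := fun _ : ℕ => Slot S A)).le _)).symm.trans
      (condExp_congr_ae (P.condExp_hist f (n + m)))).trans ?_
    exact ih (P.next f)

/-- A nonnegative functional that decreases in expectation is almost surely bounded. -/
theorem ae_bddAbove_of_next_le (P : RLParams M) (f : List (Slot S A) → ℝ) (h0 : ∀ l, 0 ≤ f l)
    (hf : ∀ l, P.next f l ≤ f l) :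
    ∀ᵐ ω ∂P.law, BddAbove (Set.range fun n => f (hist ω (n + 1))) := by
  have hsup : Supermartingale (fun n ω => f (hist ω (n + 1)))
      (Filtration.piLE (X := fun _ : ℕ => Slot S A)) P.law := by
    refine supermartingale_nat (fun n => stronglyMeasurable_hist f le_rfl)
      (fun n => P.integrable_hist f n) fun n => ?_
    filter_upwards [P.condExp_hist f n] with ω hω
    rw [hω]
    exact hf _
  have hint : ∀ n, ∫ ω, f (hist ω (n + 1)) ∂P.law ≤ ∫ ω, f (hist ω (0 + 1)) ∂P.law := fun n => by
    simpa using hsup.setIntegral_le (Nat.zero_le n) MeasurableSet.univ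
  obtain ⟨R, hR⟩ : ∃ R : NNReal, ENNReal.ofReal (∫ ω, f (hist ω (0 + 1)) ∂P.law) = R :=
    ⟨_, rfl⟩
  have := hsup.neg.exists_ae_tendsto_of_bdd (R := R) fun n => by
    rw [Pi.neg_apply, eLpNorm_neg, eLpNorm_one_eq_lintegral_enorm,
      ← ofReal_integral_norm_eq_lintegral_enorm (P.integrable_hist f n), ← hR]
    refine ENNReal.ofReal_le_ofReal (le_trans (le_of_eq ?_) (hint n))
    simp only [Real.norm_of_nonneg (h0 _)]
  filter_upwards [this] with ω ⟨c, hc⟩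
  have := hc.neg.bddAbove_range
  simpa using this

/-! ### The law of large numbers for the sampled transitions -/

theorem count_append (P : RLParams M) (l : List (Slot S A)) (x : Slot S A) (s : S) (a : A)
    (s' : S) : P.count (l ++ [x]) s a s' = P.count l s a s' +
      if x = some (s, a, s') then 1 else 0 := by
  simp [count, List.count_append, List.count_singleton]

theorem visits_append (P : RLParams M) (l : List (Slot S A)) (x : Slot S A) (s : S) (a : A) :
    P.visits (l ++ [x]) s a = P.visits l s a +
      ∑ u ∈ M.post s a, if x = some (s, a, u) then 1 else 0 := by
  simp [visits, count_append, Finset.sum_add_distrib]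

end RLParams

namespace RLParams

open MeasureTheory ProbabilityTheory Filter

variable {S : Type u} {A : Type v} [Fintype S] [Fintype A] [DecidableEq S] [DecidableEq A]
  {M : MDP S A}

/-- The change of `#(s,a)` in a slot. -/
noncomputable def visitStep (_P : RLParams M) (s : S) (a : A) (x : Slot S A) : ℝ :=
  ∑ u ∈ M.post s a, if x = some (s, a, u) then 1 else 0

/-- The change of `#(s,a,s') - T(s,a,s') * #(s,a)` in a slot. -/
noncomputable def devStep (P : RLParams M) (s : S) (a : A) (s' : S) (x : Slot S A) : ℝ :=
  (if x = some (s, a, s') then 1 else 0) - M.trans s a s' * P.visitStep s a x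

/-- The deviation of `#(s,a,s')` from its expected value given `#(s,a)`. -/
noncomputable def dev (P : RLParams M) (s : S) (a : A) (s' : S) (l : List (Slot S A)) : ℝ :=
  P.count l s a s' - M.trans s a s' * P.visits l s a

theorem visits_append_real (P : RLParams M) (l : List (Slot S A)) (x : Slot S A) (s : S) (a : A) :
    (P.visits (l ++ [x]) s a : ℝ) = P.visits l s a + P.visitStep s a x := by
  rw [visits_append, visitStep]
  push_cast
  rfl

theorem dev_append (P : RLParams M) (l : List (Slot S A)) (x : Slot S A) (s : S) (a : A)
    (s' : S) : P.dev s a s' (l ++ [x]) = P.dev s a s' l + P.devStep s a s' x := by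
  rw [dev, dev, devStep, visits_append_real, count_append]
  push_cast
  ring

theorem visitStep_some (P : RLParams M) (s : S) (a : A) (s₁ : S) (a₁ : A) (u : S) :
    P.visitStep s a (some (s₁, a₁, u)) =
      if s₁ = s ∧ a₁ = a ∧ u ∈ M.post s a then 1 else 0 := by
  unfold visitStep
  by_cases h : s₁ = s ∧ a₁ = a
  · obtain ⟨rfl, rfl⟩ := h
    simp
  · rw [if_neg fun h' => h ⟨h'.1, h'.2.1⟩]
    refine Finset.sum_eq_zero fun v _ => if_neg ?_
    simp only [Option.some.injEq, Prod.mk.injEq]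
    exact fun h' => h ⟨h'.1, h'.2.1⟩

@[simp]
theorem visitStep_none (P : RLParams M) (s : S) (a : A) : P.visitStep s a none = 0 := by
  simp [visitStep]

theorem sum_slotProb_mul (P : RLParams M) (l : List (Slot S A)) (f : Slot S A → ℝ) :
    ∑ x, P.slotProb l x * f x =
      match P.current l with
      | none => f none
      | some s => ∑ a, ∑ s', P.actionProb l s a * M.trans s a s' * f (some (s, a, s')) := by
  rw [Fintype.sum_option]
  rcases hcur : P.current l with _ | s
  · simp [slotProb, hcur]
  · simp only [slotProb, hcur, zero_mul, zero_add, Fintype.sum_prod_type]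
    rw [Finset.sum_eq_single s]
    · simp
    · intro b _ hb
      simp [hb]
    · simp

theorem sum_slotProb_devStep (P : RLParams M) (l : List (Slot S A)) {s : S} {a : A} {s' : S}
    (hs' : s' ∈ M.post s a) : ∑ x, P.slotProb l x * P.devStep s a s' x = 0 := by
  rw [sum_slotProb_mul]
  have ha := M.mem_act_of_trans_pos (M.mem_post.1 hs')
  rcases P.current l with _ | s₀
  · simp [devStep]
  · simp only
    by_cases h : s₀ = s
    · subst h
      rw [Finset.sum_eq_single a]
      · have h1 : ∀ u, P.actionProb l s₀ a * M.trans s₀ a u *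
            P.devStep s₀ a s' (some (s₀, a, u)) = P.actionProb l s₀ a *
              ((if u = s' then M.trans s₀ a u else 0) - M.trans s₀ a s' * M.trans s₀ a u) := by
          intro u
          rw [devStep, visitStep_some]
          by_cases hu : u ∈ M.post s₀ a
          · simp only [Option.some.injEq, Prod.mk.injEq, true_and, hu, and_self, if_true]
            split_ifs <;> ring
          · have : M.trans s₀ a u = 0 :=
              le_antisymm (not_lt.1 fun h => hu (M.mem_post.2 h)) (M.trans_nonneg _ _ _)
            rw [this]
            simp
        simp only [h1]
        rw [← Finset.mul_sum, Finset.sum_sub_distrib, ← Finset.mul_sum, M.trans_sum _ _ ha]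
        simp
      · intro b _ hb
        refine Finset.sum_eq_zero fun u _ => ?_
        simp [devStep, visitStep_some, hb]
      · simp
    · refine Finset.sum_eq_zero fun b _ => Finset.sum_eq_zero fun u _ => ?_
      simp [devStep, visitStep_some, h]

theorem exp_devStep_le (P : RLParams M) {s : S} {a : A} {s' : S} (hs' : s' ∈ M.post s a)
    (x : Slot S A) {r : ℝ} (hr : |r| ≤ 1) :
    Real.exp (r * P.devStep s a s' x - r ^ 2 * P.visitStep s a x) ≤
      1 + r * Real.exp (-r ^ 2) * P.devStep s a s' x := by
  have hcase : (P.visitStep s a x = 0 ∧ P.devStep s a s' x = 0) ∨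
      (P.visitStep s a x = 1 ∧ |P.devStep s a s' x| ≤ 1) := by
    rcases x with _ | ⟨s₁, a₁, u⟩
    · simp [devStep]
    · by_cases h : s₁ = s ∧ a₁ = a ∧ u ∈ M.post s a
      · right
        have h0 := M.trans_nonneg s a s'
        have h1 := M.trans_le_one s a s'
        rw [devStep, visitStep_some, if_pos h]
        refine ⟨rfl, abs_le.2 ?_⟩
        split_ifs <;> constructor <;> linarith
      · left
        rw [devStep, visitStep_some, if_neg h, if_neg]
        · simp
        · rintro ⟨⟩
          exact h ⟨rfl, rfl, hs'⟩
  rcases hcase with ⟨h1, h2⟩ | ⟨h1, h2⟩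
  · simp [h1, h2]
  · rw [h1, mul_one, sub_eq_add_neg, Real.exp_add]
    set y := P.devStep s a s' x
    have hy : |r * y| ≤ 1 := by
      rw [abs_mul]
      exact mul_le_one₀ hr (abs_nonneg _) h2
    have h3 : Real.exp (r * y) ≤ 1 + r ^ 2 + r * y := by
      have h4 := (abs_le.1 (Real.abs_exp_sub_one_sub_id_le hy)).2
      have h5 : (r * y) ^ 2 ≤ r ^ 2 := by
        rw [mul_pow]
        exact mul_le_of_le_one_right (sq_nonneg r) ((sq_le_one_iff_abs_le_one y).2 h2)
      linarith
    have h6 : (1 + r ^ 2) * Real.exp (-r ^ 2) ≤ 1 := by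
      rw [Real.exp_neg, ← div_eq_mul_inv, div_le_one (Real.exp_pos _)]
      linarith [Real.add_one_le_exp (r ^ 2)]
    calc Real.exp (r * y) * Real.exp (-r ^ 2)
        ≤ (1 + r ^ 2 + r * y) * Real.exp (-r ^ 2) := by gcongr
      _ = (1 + r ^ 2) * Real.exp (-r ^ 2) + r * Real.exp (-r ^ 2) * y := by ring
      _ ≤ _ := by gcongr

theorem next_exp_dev_le (P : RLParams M) {s : S} {a : A} {s' : S} (hs' : s' ∈ M.post s a)
    {r : ℝ} (hr : |r| ≤ 1) (l : List (Slot S A)) :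
    P.next (fun l => Real.exp (r * P.dev s a s' l - r ^ 2 * P.visits l s a)) l ≤
      Real.exp (r * P.dev s a s' l - r ^ 2 * P.visits l s a) := by
  unfold next
  set e := Real.exp (r * P.dev s a s' l - r ^ 2 * P.visits l s a)
  have h : ∀ x, P.slotProb l x * Real.exp (r * P.dev s a s' (l ++ [x]) -
      r ^ 2 * P.visits (l ++ [x]) s a) ≤
      e * P.slotProb l x + e * (r * Real.exp (-r ^ 2)) * (P.slotProb l x * P.devStep s a s' x) := by
    intro x
    rw [dev_append, visits_append_real]
    calc _ = P.slotProb l x * e *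
          Real.exp (r * P.devStep s a s' x - r ^ 2 * P.visitStep s a x) := by
          rw [mul_assoc, ← Real.exp_add]
          congr 2
          ring
      _ ≤ P.slotProb l x * e * (1 + r * Real.exp (-r ^ 2) * P.devStep s a s' x) :=
          mul_le_mul_of_nonneg_left (P.exp_devStep_le hs' x hr)
            (mul_nonneg (P.slotProb_nonneg _ _) (Real.exp_pos _).le)
      _ = _ := by ring
  refine (Finset.sum_le_sum fun x _ => h x).trans (le_of_eq ?_)
  rw [Finset.sum_add_distrib, ← Finset.mul_sum, ← Finset.mul_sum, P.sum_slotProb,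
    P.sum_slotProb_devStep l hs', mul_one, mul_zero, add_zero]

/-- The relative frequencies of a transition converge to its probability if its state-action pair
is sampled infinitely often. -/
theorem ae_tendsto_frequency (P : RLParams M) {s : S} {a : A} {s' : S} (hs' : s' ∈ M.post s a) :
    ∀ᵐ ω ∂P.law, Tendsto (fun n => P.visits (hist ω n) s a) atTop atTop →
      Tendsto (fun n => (P.count (hist ω n) s a s' : ℝ) / P.visits (hist ω n) s a) atTop
        (nhds (M.trans s a s')) := by
  have hb : ∀ r : ℝ, |r| ≤ 1 → ∀ᵐ ω ∂P.law, ∃ C, ∀ n,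
      r * P.dev s a s' (hist ω (n + 1)) - r ^ 2 * P.visits (hist ω (n + 1)) s a ≤ C := by
    intro r hr
    filter_upwards [P.ae_bddAbove_of_next_le
      (fun l => Real.exp (r * P.dev s a s' l - r ^ 2 * P.visits l s a))
      (fun l => (Real.exp_pos _).le) (P.next_exp_dev_le hs' hr)] with ω ⟨C, hC⟩
    refine ⟨C, fun n => ?_⟩
    have h1 : Real.exp _ ≤ C := hC (Set.mem_range_self n)
    have h2 := Real.add_one_le_exp
      (r * P.dev s a s' (hist ω (n + 1)) - r ^ 2 * P.visits (hist ω (n + 1)) s a)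
    linarith
  have hpos : ∀ᵐ ω ∂P.law, ∀ j : ℕ, ∃ C, ∀ n, (1 / ((j : ℝ) + 1)) * P.dev s a s' (hist ω (n + 1)) -
      (1 / ((j : ℝ) + 1)) ^ 2 * P.visits (hist ω (n + 1)) s a ≤ C :=
    ae_all_iff.2 fun j => hb _ (by
      rw [abs_of_pos (by positivity), div_le_one (by positivity)]
      linarith [Nat.cast_nonneg (α := ℝ) j])
  have hneg : ∀ᵐ ω ∂P.law, ∀ j : ℕ, ∃ C, ∀ n,
      (-(1 / ((j : ℝ) + 1))) * P.dev s a s' (hist ω (n + 1)) -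
      (-(1 / ((j : ℝ) + 1))) ^ 2 * P.visits (hist ω (n + 1)) s a ≤ C :=
    ae_all_iff.2 fun j => hb _ (by
      rw [abs_neg, abs_of_pos (by positivity), div_le_one (by positivity)]
      linarith [Nat.cast_nonneg (α := ℝ) j])
  filter_upwards [hpos, hneg] with ω h1 h2 hV
  rw [← tendsto_add_atTop_iff_nat 1]
  replace hV := (tendsto_add_atTop_iff_nat 1).2 hV
  rw [Metric.tendsto_atTop]
  intro e he
  obtain ⟨j, hj⟩ := exists_nat_one_div_lt (half_pos he)
  set r : ℝ := 1 / ((j : ℝ) + 1) with hr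
  have hr0 : 0 < r := by positivity
  obtain ⟨C₁, hC₁⟩ := h1 j
  obtain ⟨C₂, hC₂⟩ := h2 j
  rw [← hr] at hC₁ hC₂
  obtain ⟨N, hN⟩ := eventually_atTop.1 ((tendsto_natCast_atTop_atTop (R := ℝ)).comp hV
    |>.eventually_gt_atTop (max (max C₁ C₂) 0 / (r * (e / 2))))
  refine ⟨N, fun n hn => ?_⟩
  have hv := hN n hn
  simp only [Function.comp_apply] at hv
  set v : ℝ := ((P.visits (hist ω (n + 1)) s a : ℕ) : ℝ)
  have hre : 0 < r * (e / 2) := by positivity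
  have hv0 : 0 < v := lt_of_le_of_lt (by positivity) hv
  rw [div_lt_iff₀ hre] at hv
  have hA := hC₁ n
  have hB := hC₂ n
  have hm1 : C₁ < v * (r * (e / 2)) := (le_max_left _ _ |>.trans (le_max_left _ _)).trans_lt hv
  have hm2 : C₂ < v * (r * (e / 2)) := (le_max_right _ _ |>.trans (le_max_left _ _)).trans_lt hv
  have hd : |P.dev s a s' (hist ω (n + 1))| < e * v := by
    rw [abs_lt]
    have hrv : r * v < e / 2 * v := by gcongr
    constructor
    · have : r * (-P.dev s a s' (hist ω (n + 1))) < r * (e * v) := by nlinarith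
      have := lt_of_mul_lt_mul_left this hr0.le
      linarith
    · have : r * (P.dev s a s' (hist ω (n + 1))) < r * (e * v) := by nlinarith
      exact lt_of_mul_lt_mul_left this hr0.le
  rw [Real.dist_eq]
  have : (P.count (hist ω (n + 1)) s a s' : ℝ) / v - M.trans s a s' =
      P.dev s a s' (hist ω (n + 1)) / v := by
    rw [dev]
    field_simp
    rw [mul_comm v]
  rw [this, abs_div, abs_of_pos hv0, div_lt_iff₀ hv0]
  exact hd

end RLParams

/-! ### Every reachable state-action pair is sampled infinitely often -/

namespace MDP

variable {S : Type u} {A : Type v} [Fintype S] [Fintype A] [DecidableEq S] [DecidableEq A]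
  (M : MDP S A)

/-- The state `t` can be reached in exactly `d` transitions. -/
def StepsTo (t : S) : ℕ → S → Prop
  | 0, x => x = t
  | d + 1, x => ∃ a ∈ M.act x, ∃ y, 0 < M.trans x a y ∧ StepsTo t d y

theorem Reachable.exists_stepsTo {M : MDP S A} {t : S} (h : M.Reachable t) :
    ∃ d, M.StepsTo t d M.init := by
  unfold MDP.Reachable at h
  generalize M.init = x at h ⊢
  induction h using Relation.ReflTransGen.head_induction_on with
  | refl => exact ⟨0, rfl⟩
  | head hxy _ ih =>
    obtain ⟨a, ha, hy⟩ := hxy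
    obtain ⟨d, hd⟩ := ih
    exact ⟨d + 1, a, ha, _, hy, hd⟩

theorem exists_stepsTo_lt_card {t x : S} (h : ∃ d, M.StepsTo t d x) :
    ∃ d, d + 1 ≤ Fintype.card S ∧ M.StepsTo t d x := by
  classical
  have hmin : ∀ d, ∀ y, M.StepsTo t d y → (∀ i < d, ¬ M.StepsTo t i y) →
      ∀ j ≤ d, ∃ z, M.StepsTo t j z ∧ ∀ i < j, ¬ M.StepsTo t i z := by
    intro d
    induction d with
    | zero =>
      intro y hy hlt j hj
      obtain rfl := Nat.le_zero.1 hj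
      exact ⟨y, hy, hlt⟩
    | succ d ih =>
      intro y hy hlt j hj
      rcases Nat.of_le_succ hj with hj | rfl
      · obtain ⟨a, ha, z, hz, hd⟩ := hy
        exact ih z hd (fun i hi hiz => hlt (i + 1) (by omega) ⟨a, ha, z, hz, hiz⟩) j hj
      · exact ⟨y, hy, hlt⟩
  refine ⟨Nat.find h, ?_, Nat.find_spec h⟩
  choose f hf hf' using hmin (Nat.find h) x (Nat.find_spec h) fun i hi => Nat.find_min h hi
  have hinj : Function.Injective fun i : Fin (Nat.find h + 1) => f i (Nat.le_of_lt_succ i.2) := by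
    intro i j hij
    have hi := hf i (Nat.le_of_lt_succ i.2)
    have hj := hf j (Nat.le_of_lt_succ j.2)
    simp only at hij
    rcases lt_trichotomy i.1 j.1 with hlt | heq | hlt
    · exact absurd (hij ▸ hi) (hf' j (Nat.le_of_lt_succ j.2) i hlt)
    · exact Fin.ext heq
    · exact absurd (hij ▸ hj) (hf' i (Nat.le_of_lt_succ i.2) j hlt)
  simpa using Fintype.card_le_of_injective _ hinj

theorem StepsTo.notMem_goal {M : MDP S A} {t : S} (ht : t ∉ M.goal) {d : ℕ} {x : S}
    (h : M.StepsTo t d x) : x ∉ M.goal := by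
  cases d with
  | zero => exact h ▸ ht
  | succ d =>
    obtain ⟨a, ha, -⟩ := h
    exact M.notMem_goal_of_mem_act ha

end MDP

namespace RLParams

open MeasureTheory ProbabilityTheory Filter

variable {S : Type u} {A : Type v} [Fintype S] [Fintype A] [DecidableEq S] [DecidableEq A]
  {M : MDP S A}

theorem card_pos (_P : RLParams M) : 0 < Fintype.card S := Fintype.card_pos_iff.2 ⟨M.init⟩

theorem card_le_epLen (P : RLParams M) : Fintype.card S ≤ P.epLen :=
  Nat.le_mul_of_pos_left _ P.N_pos

theorem epLen_pos (P : RLParams M) : 0 < P.epLen := P.card_pos.trans_le P.card_le_epLen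

/-- `#(s,a)` plus the number of state-action pairs that have been sampled. -/
noncomputable def progress (P : RLParams M) (s : S) (a : A) (l : List (Slot S A)) : ℕ :=
  P.visits l s a + ∑ p : S × A, if P.visits l p.1 p.2 = 0 then 0 else 1

theorem visits_le_append (P : RLParams M) (l : List (Slot S A)) (x : Slot S A) (s : S) (a : A) :
    P.visits l s a ≤ P.visits (l ++ [x]) s a := by
  rw [visits_append]
  exact Nat.le_add_right _ _

theorem visits_append_some (P : RLParams M) (l : List (Slot S A)) {s : S} {a : A} {u : S}
    (hu : 0 < M.trans s a u) : P.visits (l ++ [some (s, a, u)]) s a = P.visits l s a + 1 := by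
  rw [visits_append]
  simp [M.mem_post.2 hu]

theorem sampled_le_append (P : RLParams M) (l : List (Slot S A)) (x : Slot S A) (p : S × A) :
    (if P.visits l p.1 p.2 = 0 then 0 else 1) ≤
      if P.visits (l ++ [x]) p.1 p.2 = 0 then 0 else 1 := by
  have := P.visits_le_append l x p.1 p.2
  split_ifs <;> omega

theorem progress_le_append (P : RLParams M) (s : S) (a : A) (l : List (Slot S A)) (x : Slot S A) :
    P.progress s a l ≤ P.progress s a (l ++ [x]) :=
  Nat.add_le_add (P.visits_le_append l x s a)
    (Finset.sum_le_sum fun p _ => P.sampled_le_append l x p)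

theorem progress_lt_of_target (P : RLParams M) (l : List (Slot S A)) {s : S} {a : A} {u : S}
    (hu : 0 < M.trans s a u) : P.progress s a l < P.progress s a (l ++ [some (s, a, u)]) :=
  Nat.add_lt_add_of_lt_of_le (by rw [P.visits_append_some l hu]; omega)
    (Finset.sum_le_sum fun p _ => P.sampled_le_append l _ p)

theorem progress_lt_of_new (P : RLParams M) (s : S) (a : A) (l : List (Slot S A)) {s₁ : S} {a₁ : A}
    {u : S} (h : a₁ ∈ P.unsampled l s₁) (hu : 0 < M.trans s₁ a₁ u) :
    P.progress s a l < P.progress s a (l ++ [some (s₁, a₁, u)]) := by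
  refine Nat.add_lt_add_of_le_of_lt (P.visits_le_append l _ s a)
    (Finset.sum_lt_sum (fun p _ => P.sampled_le_append l _ p) ⟨(s₁, a₁), Finset.mem_univ _, ?_⟩)
  have h0 : P.visits l s₁ a₁ = 0 := (Finset.mem_filter.1 h).2
  simp [P.visits_append_some l hu, h0]

theorem progress_le (P : RLParams M) (s : S) (a : A) (l : List (Slot S A)) :
    P.progress s a l ≤ P.visits l s a + Fintype.card (S × A) := by
  refine Nat.add_le_add_left ?_ _
  refine (Finset.sum_le_card_nsmul _ _ 1 fun p _ => ?_).trans (by simp)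
  split_ifs <;> omega

/-- Indicator of the histories with progress after time `m`. -/
noncomputable def gain (P : RLParams M) (s : S) (a : A) (m : ℕ) (l : List (Slot S A)) : ℝ :=
  if P.progress s a (l.take m) < P.progress s a l then 1 else 0

theorem gain_nonneg (P : RLParams M) (s : S) (a : A) (m : ℕ) (l : List (Slot S A)) :
    0 ≤ P.gain s a m l := by
  unfold gain; split_ifs <;> norm_num

theorem next_iterate_nonneg (P : RLParams M) {f : List (Slot S A) → ℝ} (hf : ∀ l, 0 ≤ f l) (n : ℕ)
    (l : List (Slot S A)) : 0 ≤ P.next^[n] f l := by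
  induction n generalizing l with
  | zero => exact hf l
  | succ n ih =>
    rw [Function.iterate_succ_apply']
    exact Finset.sum_nonneg fun x _ => mul_nonneg (P.slotProb_nonneg _ _) (ih _)

theorem one_le_next_of_gain (P : RLParams M) (s : S) (a : A) {m : ℕ} (n : ℕ)
    {l : List (Slot S A)} (hm : m ≤ l.length)
    (h : P.progress s a (l.take m) < P.progress s a l) : 1 ≤ P.next^[n] (P.gain s a m) l := by
  induction n generalizing l with
  | zero => exact (if_pos h).ge
  | succ n ih =>
    rw [Function.iterate_succ_apply', ← P.sum_slotProb l]
    refine Finset.sum_le_sum fun x _ => le_mul_of_one_le_right (P.slotProb_nonneg _ _) (ih ?_ ?_)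
    · rw [List.length_append]; omega
    · rw [List.take_append_of_le_length hm]
      exact h.trans_le (P.progress_le_append s a l x)

theorem one_le_next_of_unsampled (P : RLParams M) (s : S) (a : A) {m : ℕ} (n : ℕ)
    {l : List (Slot S A)} (hm : m ≤ l.length)
    (hp : P.progress s a (l.take m) ≤ P.progress s a l) {x : S}
    (hx : P.current l = some x) (hnew : (P.unsampled l x).Nonempty) :
    1 ≤ P.next^[n + 1] (P.gain s a m) l := by
  rw [Function.iterate_succ_apply', ← P.sum_slotProb l]
  refine Finset.sum_le_sum fun y _ => ?_
  by_cases hy : P.slotProb l y = 0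
  · simp [hy]
  · refine le_mul_of_one_le_right (P.slotProb_nonneg _ _) (P.one_le_next_of_gain s a n ?_ ?_)
    · rw [List.length_append]; omega
    · rw [List.take_append_of_le_length hm]
      refine hp.trans_lt ?_
      rcases y with _ | ⟨s₁, a₁, u⟩
      · simp [slotProb, hx] at hy
      · obtain rfl : s₁ = x := by
          by_contra h
          simp [slotProb, hx, h] at hy
        have hy' : P.actionProb l s₁ a₁ * M.trans s₁ a₁ u ≠ 0 := by
          simpa [slotProb, hx] using hy
        obtain ⟨ha, hu⟩ := mul_ne_zero_iff.1 hy'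
        rw [actionProb, if_pos hnew] at ha
        refine P.progress_lt_of_new s a l (P.pickNew_mem l s₁ _ hnew a₁ ?_)
          (lt_of_le_of_ne (M.trans_nonneg _ _ _) (Ne.symm hu))
        rw [PMF.mem_support_iff]
        exact fun h => ha (by rw [h, ENNReal.toReal_zero])

theorem next_ge_of_current (P : RLParams M) {f : List (Slot S A) → ℝ} (hf : ∀ l, 0 ≤ f l)
    {l : List (Slot S A)} {x : S} (hx : P.current l = some x) (a : A) :
    ∑ u, P.actionProb l x a * M.trans x a u * f (l ++ [some (x, a, u)]) ≤ P.next f l := by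
  rw [next, P.sum_slotProb_mul l fun y => f (l ++ [y]), hx]
  exact Finset.single_le_sum (f := fun b => ∑ u, P.actionProb l x b * M.trans x b u *
    f (l ++ [some (x, b, u)])) (fun b _ => Finset.sum_nonneg fun u _ =>
    mul_nonneg (mul_nonneg (P.actionProb_nonneg _ _ _) (M.trans_nonneg _ _ _)) (hf _))
    (Finset.mem_univ a)

theorem le_actionProb (P : RLParams M) {l : List (Slot S A)} {k j : ℕ} (hk : k ≠ 0)
    (hl : l.length = k * P.epLen + j) (hj : j < Fintype.card S) {x : S} {a : A} (ha : a ∈ M.act x)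
    (hold : ¬ (P.unsampled l x).Nonempty) :
    P.ε k / Fintype.card A ≤ P.actionProb l x a := by
  have hdiv : l.length / P.epLen = k := by
    rw [hl, mul_comm, Nat.mul_add_div P.epLen_pos,
      Nat.div_eq_of_lt (hj.trans_le P.card_le_epLen), add_zero]
  rw [actionProb, if_neg hold, sampling]
  simp only [hdiv, if_neg hk]
  rw [lcb, if_pos ha]
  have h1 : (0 : ℝ) < (M.act x).card := by exact_mod_cast Finset.card_pos.2 ⟨a, ha⟩
  have h2 : ((M.act x).card : ℝ) ≤ Fintype.card A := by exact_mod_cast Finset.card_le_univ _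
  have h3 := P.ε_pos k
  have h4 := P.ε_le_one k
  have h5 : P.ε k / Fintype.card A ≤ P.ε k / (M.act x).card :=
    div_le_div_of_nonneg_left h3.le h1 h2
  refine h5.trans (le_add_of_nonneg_right ?_)
  split_ifs <;> linarith

theorem current_append (P : RLParams M) {l : List (Slot S A)} {x y : S} {a : A}
    (hl : (l.length + 1) % Fintype.card S ≠ 0) (hy : y ∉ M.goal) :
    P.current (l ++ [some (x, a, y)]) = some y := by
  rw [current, List.length_append, List.length_singleton, if_neg hl]
  simp [hy]

theorem le_next_gain (P : RLParams M) {s : S} {a : A} (ha : a ∈ M.act s) {k : ℕ} (hk : k ≠ 0)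
    {m : ℕ} (d j : ℕ) (hd : j + d + 1 ≤ Fintype.card S) {l : List (Slot S A)}
    (hl : l.length = k * P.epLen + j) (hm : m ≤ l.length)
    (hp : P.progress s a (l.take m) ≤ P.progress s a l) {x : S}
    (hx : P.current l = some x) (hsteps : M.StepsTo s d x) :
    (P.ε k / Fintype.card A * P.pmin) ^ (d + 1) ≤ P.next^[d + 1] (P.gain s a m) l := by
  have hs := M.notMem_goal_of_mem_act ha
  have hA : (1 : ℝ) ≤ Fintype.card A := by
    exact_mod_cast Fintype.card_pos_iff.2 ⟨a⟩
  have hpmin : P.pmin ≤ 1 := by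
    obtain ⟨u, -, hu⟩ : ∃ u ∈ Finset.univ, 0 < M.trans s a u := by
      by_contra! h
      have := Finset.sum_nonpos h
      rw [M.trans_sum s a ha] at this
      linarith
    exact (P.pmin_le s a u hu).trans (M.trans_le_one s a u)
  have hε : P.ε k / Fintype.card A ≤ 1 := by
    rw [div_le_one (by linarith)]
    exact (P.ε_le_one k).trans hA
  have hε0 : 0 < P.ε k / Fintype.card A := div_pos (P.ε_pos k) (by linarith)
  have hp0 := P.pmin_pos
  have hq : P.ε k / Fintype.card A * P.pmin ≤ 1 := mul_le_one₀ hε hp0.le hpmin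
  induction d generalizing l j x with
  | zero =>
    by_cases hnew : (P.unsampled l x).Nonempty
    · exact (pow_le_one₀ (by positivity) hq).trans (P.one_le_next_of_unsampled s a 0 hm hp hx hnew)
    · obtain rfl : x = s := hsteps
      refine le_trans ?_ (P.next_ge_of_current (P.gain_nonneg x a m) hx a)
      have h1 : ∀ u, P.actionProb l x a * M.trans x a u ≤ P.actionProb l x a * M.trans x a u *
          P.gain x a m (l ++ [some (x, a, u)]) := by
        intro u
        rcases (M.trans_nonneg x a u).eq_or_lt with hu | hu
        · simp [← hu]
        · rw [gain, if_pos, mul_one]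
          rw [List.take_append_of_le_length hm]
          exact hp.trans_lt (P.progress_lt_of_target l hu)
      refine le_trans ?_ (Finset.sum_le_sum fun u _ => h1 u)
      rw [← Finset.mul_sum, M.trans_sum x a ha, mul_one, zero_add, pow_one]
      refine le_trans (mul_le_of_le_one_right hε0.le hpmin) ?_
      exact P.le_actionProb hk hl (by omega) ha hnew
  | succ d ih =>
    by_cases hnew : (P.unsampled l x).Nonempty
    · exact (pow_le_one₀ (by positivity) hq).trans (P.one_le_next_of_unsampled s a _ hm hp hx hnew)
    · obtain ⟨b, hb, y, hy, hyd⟩ := hsteps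
      rw [Function.iterate_succ_apply']
      have hnn := P.next_iterate_nonneg (P.gain_nonneg s a m) (d + 1)
      refine le_trans ?_ (P.next_ge_of_current hnn hx b)
      refine le_trans ?_ (Finset.single_le_sum (f := fun u => P.actionProb l x b * M.trans x b u *
        (P.next^[d + 1] (P.gain s a m)) (l ++ [some (x, b, u)]))
        (fun u _ => mul_nonneg (mul_nonneg (P.actionProb_nonneg _ _ _) (M.trans_nonneg _ _ _))
          (hnn _)) (Finset.mem_univ y))
      have hmod : (l.length + 1) % Fintype.card S ≠ 0 := by
        rw [hl, epLen, ← mul_assoc, add_assoc, Nat.mul_add_mod_self_right, Nat.mod_eq_of_lt]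
        · omega
        · omega
      have := ih (j + 1) (by omega) (l := l ++ [some (x, b, y)])
        (by rw [List.length_append, hl]; rfl) (by rw [List.length_append]; omega)
        (by
          rw [List.take_append_of_le_length hm]
          exact hp.trans (P.progress_le_append s a l _))
        (P.current_append hmod (hyd.notMem_goal hs)) hyd
      rw [pow_succ']
      have h1 := P.le_actionProb hk hl (by omega) hb hnew
      have h2 := P.pmin_le x b y hy
      have h3 := P.actionProb_nonneg l x b
      gcongr

theorem hist_take (ω : ℕ → Slot S A) {m n : ℕ} (h : m ≤ n) :
    (hist ω n).take m = hist ω m := by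
  refine List.ext_getElem (by simp [h]) fun i h1 h2 => ?_
  simp [hist]

theorem progress_hist_mono (P : RLParams M) (s : S) (a : A) (ω : ℕ → Slot S A) :
    Monotone fun n => P.progress s a (hist ω n) :=
  monotone_nat_of_le_succ fun n => by
    rw [hist_succ]
    exact P.progress_le_append s a _ _

theorem ae_frequently_progress (P : RLParams M)
    (hε : ¬ Summable fun k => P.ε k ^ Fintype.card S) {s : S} {a : A} (ha : a ∈ M.act s)
    (hs : M.Reachable s) : ∀ᵐ ω ∂P.law, ∃ᶠ k in atTop, ∃ n,
      P.progress s a (hist ω (k * P.epLen)) < P.progress s a (hist ω n) := by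
  obtain ⟨d, hd, hsteps⟩ := M.exists_stepsTo_lt_card hs.exists_stepsTo
  have hE := P.epLen_pos
  have hdE := hd.trans P.card_le_epLen
  let F : Filtration ℕ (inferInstance : MeasurableSpace (ℕ → Slot S A)) :=
    { seq := fun k => (Filtration.piLE (X := fun _ : ℕ => Slot S A)) ((k + 1) * P.epLen - 1)
      mono' := fun i j hij => (Filtration.piLE (X := fun _ : ℕ => Slot S A)).mono
        (Nat.sub_le_sub_right (Nat.mul_le_mul_right _ (by omega)) 1)
      le' := fun k => (Filtration.piLE (X := fun _ : ℕ => Slot S A)).le _ }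
  let B : ℕ → Set (ℕ → Slot S A) := fun k =>
    {ω | P.gain s a (k * P.epLen) (hist ω (k * P.epLen + d + 1)) = 1}
  have hB : ∀ k, MeasurableSet[F k] (B k) := fun k =>
    (stronglyMeasurable_hist (P.gain s a (k * P.epLen)) (m := k * P.epLen + d) (by
      rw [Nat.add_mul, one_mul]; omega)).measurable (measurableSet_singleton (1 : ℝ))
  have hind : ∀ k, (B k).indicator (1 : (ℕ → Slot S A) → ℝ) =
      fun ω => P.gain s a (k * P.epLen) (hist ω (k * P.epLen + d + 1)) := by
    intro k
    ext ω
    by_cases h : P.progress s a ((hist ω (k * P.epLen + d + 1)).take (k * P.epLen)) <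
        P.progress s a (hist ω (k * P.epLen + d + 1)) <;>
      simp [B, Set.indicator, gain, h]
  have hA : (1 : ℝ) ≤ Fintype.card A := by
    exact_mod_cast Fintype.card_pos_iff.2 ⟨a⟩
  have hce : ∀ᵐ ω ∂P.law, ∀ k, (P.ε (k + 1) / Fintype.card A * P.pmin) ^ (d + 1) ≤
      (P.law[(B (k + 1)).indicator 1 | F k]) ω := by
    rw [ae_all_iff]
    intro k
    have hpos : 0 < (k + 1) * P.epLen := by positivity
    have h := P.condExp_hist_add (P.gain s a ((k + 1) * P.epLen)) ((k + 1) * P.epLen - 1) (d + 1)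
    have e1 : (k + 1) * P.epLen - 1 + (d + 1) + 1 = (k + 1) * P.epLen + d + 1 := by omega
    have e2 : (k + 1) * P.epLen - 1 + 1 = (k + 1) * P.epLen := by omega
    rw [e1, e2, ← hind] at h
    filter_upwards [h] with ω hω
    refine le_of_le_of_eq ?_ hω.symm
    refine P.le_next_gain ha (Nat.succ_ne_zero k) d 0 (by omega) (by simp) (by simp)
      (by rw [hist_take ω le_rfl]) (x := M.init) ?_ hsteps
    have : (k + 1) * P.epLen % Fintype.card S = 0 := by
      rw [epLen, ← mul_assoc, Nat.mul_mod_left]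
    simp [current, this, hsteps.notMem_goal (M.notMem_goal_of_mem_act ha)]
  filter_upwards [ae_mem_limsup_atTop_iff P.law hB, hce] with ω h1 h2
  have h3 : ω ∈ limsup B atTop := by
    rw [h1]
    set c : ℝ := (P.pmin / Fintype.card A) ^ (d + 1) with hc
    have hc0 : 0 < c := pow_pos (div_pos P.pmin_pos (by linarith)) _
    have hdiv : Tendsto (fun n => ∑ k ∈ Finset.range n, P.ε (k + 1) ^ Fintype.card S) atTop
        atTop := by
      rw [← not_summable_iff_tendsto_nat_atTop_of_nonneg
        (fun k => pow_nonneg (P.ε_pos _).le _)]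
      rwa [summable_nat_add_iff 1 (f := fun k => P.ε k ^ Fintype.card S)]
    refine tendsto_atTop_mono (fun n => ?_) (hdiv.const_mul_atTop hc0)
    rw [Finset.mul_sum]
    refine Finset.sum_le_sum fun k _ => le_trans ?_ (h2 k)
    have : (P.ε (k + 1) / Fintype.card A * P.pmin) ^ (d + 1) = c * P.ε (k + 1) ^ (d + 1) := by
      rw [hc, ← mul_pow]
      ring
    rw [this]
    exact mul_le_mul_of_nonneg_left (pow_le_pow_of_le_one (P.ε_pos _).le (P.ε_le_one _) hd) hc0.le
  rw [mem_limsup_iff_frequently_mem] at h3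
  refine h3.mono fun k hk => ⟨k * P.epLen + d + 1, ?_⟩
  by_contra hlt
  have : P.gain s a (k * P.epLen) (hist ω (k * P.epLen + d + 1)) = 1 := hk
  rw [gain, hist_take ω (by omega), if_neg hlt] at this
  exact zero_ne_one this

/-- Almost surely, a reachable state-action pair is sampled infinitely often. -/
theorem ae_tendsto_visits (P : RLParams M)
    (hε : ¬ Summable fun k => P.ε k ^ Fintype.card S) {s : S} {a : A} (ha : a ∈ M.act s)
    (hs : M.Reachable s) :
    ∀ᵐ ω ∂P.law, Tendsto (fun n => P.visits (hist ω n) s a) atTop atTop := by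
  filter_upwards [P.ae_frequently_progress hε ha hs] with ω hω
  have hmono := P.progress_hist_mono s a ω
  have hE := P.epLen_pos
  have hunb : ∀ b, ∃ n, b ≤ P.progress s a (hist ω n) := by
    intro b
    induction b with
    | zero => exact ⟨0, Nat.zero_le _⟩
    | succ b ih =>
      obtain ⟨n, hn⟩ := ih
      obtain ⟨k, hk, n', hn'⟩ := (frequently_atTop.1 hω) n
      refine ⟨n', lt_of_le_of_lt (hn.trans (hmono ?_)) hn'⟩
      exact hk.trans (Nat.le_mul_of_pos_right k hE)
  have h1 := tendsto_atTop_atTop_of_monotone hmono hunb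
  refine tendsto_atTop_mono (fun n => ?_) (tendsto_atTop_mono
    (fun n => (Nat.sub_le_iff_le_add.2 (P.progress_le s a (hist ω n)))) ?_)
  · exact le_rfl
  · exact (tendsto_sub_atTop_nat (Fintype.card (S × A))).comp h1

end RLParams

/-! ### Sums over finite sequences -/

theorem hasSum_list_of_cons {α : Type*} [Fintype α] {f : List α → ℝ} {b : α → ℝ}
    (h : ∀ x, HasSum (fun π => f (x :: π)) (b x)) : HasSum f (f [] + ∑ x, b x) := by
  classical
  have h1 : HasSum (fun π : List α => if π = [] then f [] else 0) (f []) := hasSum_ite_eq [] (f [])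
  have h2 : ∀ x, HasSum (Function.extend (List.cons x) (fun π => f (x :: π)) 0) (b x) := fun x =>
    (hasSum_extend_zero (List.cons_injective)).2 (h x)
  refine (h1.add (hasSum_sum fun x (_ : x ∈ Finset.univ) => h2 x)).congr_fun ?_
  rintro (_ | ⟨y, τ⟩)
  · rw [if_pos rfl, Finset.sum_eq_zero, add_zero]
    intro x _
    rw [Function.extend_apply']
    · rfl
    · rintro ⟨π, hπ⟩
      simp at hπ
  · rw [if_neg (by simp), zero_add, Finset.sum_eq_single y]
    · exact (List.cons_injective.extend_apply (fun π => f (y :: π)) 0 τ).symm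
    · intro x _ hx
      rw [Function.extend_apply']
      · rfl
      · rintro ⟨π, hπ⟩
        exact hx (List.cons_eq_cons.1 hπ).1
    · simp

theorem sum_list_le_cons {α : Type*} [Fintype α] [DecidableEq α] {f : List α → ℝ}
    (hf : ∀ π, 0 ≤ f π) (F : Finset (List α)) :
    ∑ π ∈ F, f π ≤
      f [] + ∑ x, ∑ π ∈ F.preimage (List.cons x) List.cons_injective.injOn, f (x :: π) := by
  have hsub : F ⊆ insert [] (Finset.univ.biUnion fun x =>
      (F.preimage (List.cons x) List.cons_injective.injOn).image (List.cons x)) := by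
    rintro (_ | ⟨x, π⟩) hπ
    · exact Finset.mem_insert_self _ _
    · refine Finset.mem_insert_of_mem (Finset.mem_biUnion.2 ⟨x, Finset.mem_univ _, ?_⟩)
      exact Finset.mem_image_of_mem _ (Finset.mem_preimage.2 hπ)
  refine (Finset.sum_le_sum_of_subset_of_nonneg hsub fun π _ _ => hf π).trans (le_of_eq ?_)
  rw [Finset.sum_insert (by simp), Finset.sum_biUnion]
  · congr 1
    refine Finset.sum_congr rfl fun x _ => ?_
    rw [Finset.sum_image List.cons_injective.injOn]
  · intro x _ y _ hxy
    refine Finset.disjoint_left.2 fun π h1 h2 => ?_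
    obtain ⟨π₁, -, rfl⟩ := Finset.mem_image.1 h1
    obtain ⟨π₂, -, h⟩ := Finset.mem_image.1 h2
    exact hxy (List.cons_eq_cons.1 h).1.symm

namespace MDP

variable {S : Type u} {A : Type v} [Fintype S] [Fintype A] [DecidableEq S] [DecidableEq A]
  (M : MDP S A)

/-! ### Probabilities of runs -/

theorem runProb_nonneg (σ : M.Strategy) (s : S) (π : List (A × S)) : 0 ≤ M.runProb σ s π := by
  induction π generalizing s with
  | nil => exact zero_le_one
  | cons x π ih => exact mul_nonneg (mul_nonneg (σ.nonneg _ _) (M.trans_nonneg _ _ _)) (ih _)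

theorem goalProb_nonneg (σ : M.Strategy) (s : S) (π : List (A × S)) : 0 ≤ M.goalProb σ s π := by
  unfold goalProb
  split_ifs
  · exact M.runProb_nonneg σ s π
  · exact le_rfl

theorem goalProb_nil_of_mem (σ : M.Strategy) {s : S} (hs : s ∈ M.goal) :
    M.goalProb σ s [] = 1 := if_pos hs

theorem goalProb_nil_of_notMem (σ : M.Strategy) {s : S} (hs : s ∉ M.goal) :
    M.goalProb σ s [] = 0 := if_neg hs

theorem goalProb_cons_of_mem (σ : M.Strategy) {s : S} (hs : s ∈ M.goal) (x : A × S)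
    (π : List (A × S)) : M.goalProb σ s (x :: π) = 0 := if_neg fun h => h.1 hs

theorem goalProb_cons_of_notMem (σ : M.Strategy) {s : S} (hs : s ∉ M.goal) (x : A × S)
    (π : List (A × S)) : M.goalProb σ s (x :: π) =
      σ.prob s x.1 * M.trans s x.1 x.2 * M.goalProb σ x.2 π := by
  unfold goalProb
  by_cases h : M.EndsInGoal x.2 π
  · rw [if_pos h, if_pos ⟨hs, h⟩]
    rfl
  · rw [if_neg h, if_neg fun h' => h h'.2, mul_zero]

theorem sum_prob_mul_trans (σ : M.Strategy) {s : S} (hs : s ∉ M.goal) :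
    ∑ x : A × S, σ.prob s x.1 * M.trans s x.1 x.2 = 1 := by
  rw [Fintype.sum_prod_type, ← σ.sum_eq_one s hs]
  refine Finset.sum_congr rfl fun a _ => ?_
  simp only
  rw [← Finset.mul_sum]
  by_cases ha : a ∈ M.act s
  · rw [M.trans_sum s a ha, mul_one]
  · rw [σ.disabled s a ha, zero_mul]

/-- A superharmonic function bounds the discounted probabilities to reach the goal. -/
theorem sum_goalProb_le (σ : M.Strategy) {r : ℝ} (hr : 0 ≤ r) {W : S → ℝ} {D : S → Prop}
    (hD : ∀ s a s', D s → 0 < M.trans s a s' → D s') (hW : ∀ s, 0 ≤ W s)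
    (hgoal : ∀ s ∈ M.goal, 1 ≤ W s)
    (hstep : ∀ s, s ∉ M.goal → D s →
      ∑ x : A × S, σ.prob s x.1 * M.trans s x.1 x.2 * (r * W x.2) ≤ W s)
    (s : S) (hs : D s) (F : Finset (List (A × S))) :
    ∑ π ∈ F, M.goalProb σ s π * r ^ π.length ≤ W s := by
  suffices H : ∀ n s, D s → ∀ F : Finset (List (A × S)), (∀ π ∈ F, π.length < n) →
      ∑ π ∈ F, M.goalProb σ s π * r ^ π.length ≤ W s from
    H (F.sup List.length + 1) s hs F fun π hπ => Nat.lt_succ_of_le (Finset.le_sup hπ)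
  intro n
  induction n with
  | zero =>
    intro s _ F hF
    rw [Finset.sum_eq_zero fun π hπ => absurd (hF π hπ) (Nat.not_lt_zero _)]
    exact hW s
  | succ n ih =>
    intro s hs F hF
    refine (sum_list_le_cons (fun π => mul_nonneg (M.goalProb_nonneg σ s π)
      (pow_nonneg hr _)) F).trans ?_
    by_cases hg : s ∈ M.goal
    · simp [M.goalProb_nil_of_mem σ hg, M.goalProb_cons_of_mem σ hg, hgoal s hg]
    · rw [M.goalProb_nil_of_notMem σ hg, zero_mul, zero_add]
      refine le_trans (Finset.sum_le_sum fun x _ => ?_) (hstep s hg hs)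
      have h1 : ∀ π, M.goalProb σ s (x :: π) * r ^ (x :: π).length =
          σ.prob s x.1 * M.trans s x.1 x.2 * (r * (M.goalProb σ x.2 π * r ^ π.length)) := by
        intro π
        rw [M.goalProb_cons_of_notMem σ hg, List.length_cons, pow_succ]
        ring
      simp only [h1]
      rw [← Finset.mul_sum, ← Finset.mul_sum]
      rcases (M.trans_nonneg s x.1 x.2).eq_or_lt with h | h
      · simp [← h]
      · refine mul_le_mul_of_nonneg_left (mul_le_mul_of_nonneg_left (ih x.2 (hD _ _ _ hs h) _ ?_)
          hr) (mul_nonneg (σ.nonneg _ _) (M.trans_nonneg _ _ _))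
        intro π hπ
        exact Nat.lt_of_succ_lt_succ (hF _ (Finset.mem_preimage.1 hπ))

theorem summable_goalProb (σ : M.Strategy) (s : S) : Summable (M.goalProb σ s) := by
  refine summable_of_sum_le (c := 1) (M.goalProb_nonneg σ s) fun F => ?_
  have := M.sum_goalProb_le σ zero_le_one (W := fun _ => 1) (D := fun _ => True)
    (fun _ _ _ _ _ => trivial) (fun _ => zero_le_one) (fun _ _ => le_rfl)
    (fun s hs _ => by simp [M.sum_prob_mul_trans σ hs]) s trivial F
  simpa using this

/-- The probability to reach the goal. -/
noncomputable def reachProb (σ : M.Strategy) (s : S) : ℝ := ∑' π, M.goalProb σ s π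

theorem hasSum_reachProb (σ : M.Strategy) (s : S) :
    HasSum (M.goalProb σ s) (M.reachProb σ s) := (M.summable_goalProb σ s).hasSum

theorem reachProb_of_mem (σ : M.Strategy) {s : S} (hs : s ∈ M.goal) : M.reachProb σ s = 1 := by
  have h := hasSum_list_of_cons (f := M.goalProb σ s) (b := fun _ => 0) fun x => by
    simp only [M.goalProb_cons_of_mem σ hs]
    exact hasSum_zero
  rw [(M.hasSum_reachProb σ s).unique h, M.goalProb_nil_of_mem σ hs]
  simp

theorem reachProb_of_notMem (σ : M.Strategy) {s : S} (hs : s ∉ M.goal) :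
    M.reachProb σ s = ∑ x : A × S, σ.prob s x.1 * M.trans s x.1 x.2 * M.reachProb σ x.2 := by
  have h := hasSum_list_of_cons (f := M.goalProb σ s)
    (b := fun x => σ.prob s x.1 * M.trans s x.1 x.2 * M.reachProb σ x.2) fun x => by
    simp only [M.goalProb_cons_of_notMem σ hs]
    exact (M.hasSum_reachProb σ x.2).mul_left _
  rw [(M.hasSum_reachProb σ s).unique h, M.goalProb_nil_of_notMem σ hs, zero_add]

theorem reachProb_le_one (σ : M.Strategy) (s : S) : M.reachProb σ s ≤ 1 := by
  refine (M.summable_goalProb σ s).tsum_le_of_sum_le fun F => ?_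
  have := M.sum_goalProb_le σ zero_le_one (W := fun _ => 1) (D := fun _ => True)
    (fun _ _ _ _ _ => trivial) (fun _ => zero_le_one) (fun _ _ => le_rfl)
    (fun s hs _ => by simp [M.sum_prob_mul_trans σ hs]) s trivial F
  simpa using this

theorem reachProb_eq_one_of_step (σ : M.Strategy) {s : S} (h1 : M.reachProb σ s = 1) {a : A}
    {s' : S} (ha : 0 < σ.prob s a) (ht : 0 < M.trans s a s') : M.reachProb σ s' = 1 := by
  have hs : s ∉ M.goal := M.notMem_goal_of_mem_act (M.mem_act_of_trans_pos ht)
  by_contra hne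
  have hlt := lt_of_le_of_ne (M.reachProb_le_one σ s') hne
  rw [M.reachProb_of_notMem σ hs, ← M.sum_prob_mul_trans σ hs] at h1
  refine absurd h1 (ne_of_lt (Finset.sum_lt_sum (fun x _ => ?_) ⟨(a, s'), Finset.mem_univ _, ?_⟩))
  · exact mul_le_of_le_one_right (mul_nonneg (σ.nonneg _ _) (M.trans_nonneg _ _ _))
      (M.reachProb_le_one σ _)
  · exact mul_lt_of_lt_one_right (mul_pos ha ht) hlt

/-! ### Contracting MDPs have no traps -/

open scoped Classical in
/-- Stay in `X` by means of `f`, and choose actions uniformly elsewhere. -/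
noncomputable def trapStrategy (X : S → Prop) (f : S → A)
    (hf : ∀ s, X s → s ∉ M.goal ∧ f s ∈ M.act s) : M.Strategy where
  prob s a := if X s then (if a = f s then 1 else 0)
    else if a ∈ M.act s then 1 / (M.act s).card else 0
  nonneg s a := by split_ifs <;> positivity
  disabled s a ha := by
    by_cases h : X s
    · rw [if_pos h, if_neg]
      rintro rfl
      exact ha (hf s h).2
    · rw [if_neg h, if_neg ha]
  sum_eq_one s hs := by
    by_cases h : X s
    · simp [h]
    · have : ((M.act s).card : ℝ) ≠ 0 := by exact_mod_cast (M.act_nonempty s hs).card_pos.ne'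
      simp only [h, if_false]
      rw [Finset.sum_ite_mem, Finset.univ_inter, Finset.sum_const, nsmul_eq_mul]
      field_simp

/-- In a contracting MDP, no reachable state lies in a set of states in which the goal can be
avoided forever. -/
theorem Contracting.not_trap {M : MDP S A} (hM : M.Contracting) {X : S → Prop}
    (hX : ∀ s, X s → s ∉ M.goal ∧ ∃ a ∈ M.act s, ∀ s', 0 < M.trans s a s' → X s')
    {s : S} (hs : M.Reachable s) : ¬ X s := by
  intro hXs
  have : Nonempty A := (hX s hXs).2.nonempty
  choose! f hf using fun s h => (hX s h).2
  let σ := M.trapStrategy X f fun s h => ⟨(hX s h).1, (hf s h).1⟩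
  have h0 : ∀ π s, X s → M.goalProb σ s π = 0 := by
    intro π
    induction π with
    | nil => exact fun s h => M.goalProb_nil_of_notMem σ (hX s h).1
    | cons x π ih =>
      intro s h
      rw [M.goalProb_cons_of_notMem σ (hX s h).1]
      by_cases hx : x.1 = f s
      · rcases (M.trans_nonneg s x.1 x.2).eq_or_lt with ht | ht
        · simp [← ht]
        · rw [ih x.2 ((hf s h).2 _ (hx ▸ ht)), mul_zero]
      · have : σ.prob s x.1 = 0 := by simp [σ, trapStrategy, h, hx]
        simp [this]
  have hnot : ∀ s, M.reachProb σ s = 1 → ¬ X s := by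
    intro s h h'
    rw [reachProb] at h
    simp [h0 _ s h'] at h
  refine hnot s ?_ hXs
  clear hXs
  induction hs with
  | refl => exact (M.hasSum_reachProb σ M.init).unique (hM σ)
  | @tail s₁ s₂ _ hstep ih =>
    obtain ⟨a, ha, ht⟩ := hstep
    refine M.reachProb_eq_one_of_step σ ih (a := a) ?_ ht
    have hc : (0 : ℝ) < (M.act s₁).card := by exact_mod_cast Finset.card_pos.2 ⟨a, ha⟩
    simp only [σ, trapStrategy, hnot _ ih, if_false, ha, if_true]
    positivity

end MDP

namespace MDP

variable {S : Type u} {A : Type v} [Fintype S] [Fintype A] [DecidableEq S] [DecidableEq A]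
  (M : MDP S A)

/-! ### Weights -/

/-- A weight function with respect to which the Bellman operator is a contraction on the reachable
states. -/
structure Weight where
  w : S → ℝ
  β : ℝ
  β_pos : 0 < β
  β_lt_one : β < 1
  one_le : ∀ s, 1 ≤ w s
  le_two : ∀ s, w s ≤ 2
  sum_le : ∀ s, M.Reachable s → s ∉ M.goal → ∀ a ∈ M.act s,
    ∑ s', M.trans s a s' * w s' ≤ β * w s

variable {M}

theorem Reachable.step {s s' : S} {a : A} (h : M.Reachable s) (ht : 0 < M.trans s a s') :
    M.Reachable s' :=
  Relation.ReflTransGen.tail h ⟨a, M.mem_act_of_trans_pos ht, ht⟩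

variable (M) in
/-- Under every strategy, the goal is reached within `n` transitions with positive probability. -/
def GoalWithin : ℕ → S → Prop
  | 0, s => s ∈ M.goal
  | n + 1, s => ∀ a ∈ M.act s, ∃ s', 0 < M.trans s a s' ∧ GoalWithin n s'

theorem GoalWithin.succ {n : ℕ} {s : S} (h : M.GoalWithin n s) : M.GoalWithin (n + 1) s := by
  induction n generalizing s with
  | zero =>
    intro a ha
    exact absurd h (M.notMem_goal_of_mem_act ha)
  | succ n ih =>
    intro a ha
    obtain ⟨s', ht, hs'⟩ := h a ha
    exact ⟨s', ht, ih hs'⟩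

theorem GoalWithin.mono {m n : ℕ} (hmn : m ≤ n) {s : S} (h : M.GoalWithin m s) :
    M.GoalWithin n s := Nat.le_induction h (fun _ _ ih => ih.succ) n hmn

theorem Contracting.exists_goalWithin (hM : M.Contracting) {s : S} (hs : M.Reachable s) :
    ∃ n, M.GoalWithin n s := by
  by_contra hX
  refine hM.not_trap (X := fun s => ¬ ∃ n, M.GoalWithin n s) (fun s h => ⟨fun hg => h ⟨0, hg⟩, ?_⟩)
    hs hX
  by_contra! hc
  have : Nonempty S := ⟨s⟩
  choose! f hf n hn using hc
  refine h ⟨(M.act s).sup n + 1, fun a ha => ⟨f a, hf a ha, ?_⟩⟩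
  exact (hn a ha).mono (Finset.le_sup ha)

theorem Contracting.nonempty_weight (hM : M.Contracting) {p : ℝ} (hp : 0 < p)
    (hpT : ∀ s a s', 0 < M.trans s a s' → p ≤ M.trans s a s') : Nonempty M.Weight := by
  classical
  let rank : S → ℕ := fun s => sInf {n | M.GoalWithin n s}
  let θ : ℝ := min p 1 / 2
  have hp1 : 0 < min p 1 := lt_min hp one_pos
  have hθ : 0 < θ := by positivity
  have hθ1 : θ ≤ 1 := by
    have := min_le_right p 1
    simp only [θ]
    linarith
  let N := Finset.univ.sup rank
  let κ := θ ^ N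
  have hκ : 0 < κ := pow_pos hθ _
  have hκ1 : κ ≤ 1 := pow_le_one₀ hθ.le hθ1
  refine ⟨⟨fun s => 2 - θ ^ rank s, 1 - κ / 2, by linarith, by linarith, fun s => ?_, fun s => ?_,
    fun s hs hg a ha => ?_⟩⟩
  · linarith [pow_le_one₀ (n := rank s) hθ.le hθ1]
  · linarith [pow_pos hθ (rank s)]
  · have hmem : M.GoalWithin (rank s) s := Nat.sInf_mem (hM.exists_goalWithin hs)
    obtain ⟨r, hr⟩ : ∃ r, rank s = r + 1 := by
      refine Nat.exists_eq_succ_of_ne_zero fun h0 => hg ?_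
      rw [h0] at hmem
      exact hmem
    rw [hr] at hmem
    obtain ⟨t, ht, htr⟩ := hmem a ha
    have hrank : rank t ≤ r := Nat.sInf_le htr
    have h1 : ∑ s', M.trans s a s' * (2 - θ ^ rank s') ≤ 2 - M.trans s a t * θ ^ r := by
      have h2 : ∑ s', M.trans s a s' * (2 - θ ^ rank s') =
          2 - ∑ s', M.trans s a s' * θ ^ rank s' := by
        simp only [mul_sub, Finset.sum_sub_distrib, ← Finset.sum_mul, M.trans_sum s a ha]
        ring
      rw [h2]
      refine sub_le_sub_left (le_trans ?_ (Finset.single_le_sum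
        (f := fun s' => M.trans s a s' * θ ^ rank s')
        (fun s' _ => mul_nonneg (M.trans_nonneg _ _ _) (pow_nonneg hθ.le _))
        (Finset.mem_univ t))) 2
      exact mul_le_mul_of_nonneg_left (pow_le_pow_of_le_one hθ.le hθ1 hrank) ht.le
    have h3 : 2 * θ ≤ M.trans s a t := by
      refine le_trans ?_ (hpT s a t ht)
      simp only [θ]
      linarith [min_le_left p 1]
    have h4 : θ ^ (r + 1) ≤ M.trans s a t * θ ^ r - θ ^ (r + 1) := by
      have := mul_le_mul_of_nonneg_right h3 (pow_nonneg hθ.le r)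
      rw [pow_succ']
      linarith
    have h5 : κ ≤ θ ^ (r + 1) := by
      rw [← hr]
      exact pow_le_pow_of_le_one hθ.le hθ1 (Finset.le_sup (Finset.mem_univ s))
    rw [hr]
    have h6 : 0 < θ ^ (r + 1) := by positivity
    nlinarith

/-- Maximum principle: a function that is nonpositive in the goal states and subharmonic under some
choice of actions is nonpositive. -/
theorem Weight.nonpos_of_subharmonic (w : M.Weight) {D : S → ℝ}
    (hgoal : ∀ s ∈ M.goal, M.Reachable s → D s ≤ 0)
    (hstep : ∀ s, s ∉ M.goal → M.Reachable s → ∃ a ∈ M.act s, D s ≤ ∑ s', M.trans s a s' * D s')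
    {s : S} (hs : M.Reachable s) : D s ≤ 0 := by
  classical
  have hw : ∀ s, 0 < w.w s := fun s => one_pos.trans_le (w.one_le s)
  obtain ⟨t, ht, hmax⟩ := (Finset.univ.filter fun s => M.Reachable s).exists_max_image
    (fun s => D s / w.w s) ⟨s, by simpa using hs⟩
  simp only [Finset.mem_filter, Finset.mem_univ, true_and] at ht hmax
  by_contra! hpos
  have hm : 0 < D t / w.w t := (div_pos hpos (hw s)).trans_le (hmax s hs)
  set m := D t / w.w t with hmdef
  have hDt : D t = m * w.w t := by rw [hmdef, div_mul_cancel₀ _ (hw t).ne']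
  have hDtpos : 0 < D t := hDt ▸ mul_pos hm (hw t)
  have htg : t ∉ M.goal := fun h => absurd (hgoal t h ht) (not_le.2 hDtpos)
  obtain ⟨a, ha, hle⟩ := hstep t htg ht
  have h1 : ∑ s', M.trans t a s' * D s' ≤ m * ∑ s', M.trans t a s' * w.w s' := by
    rw [Finset.mul_sum]
    refine Finset.sum_le_sum fun s' _ => ?_
    rcases (M.trans_nonneg t a s').eq_or_lt with h | h
    · simp [← h]
    · have := hmax s' (ht.step h)
      rw [div_le_iff₀ (hw s')] at this
      nlinarith
  have h2 := mul_le_mul_of_nonneg_left (w.sum_le t ht htg a ha) hm.le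
  have h3 := w.β_lt_one
  nlinarith

/-! ### Bellman equations -/

theorem maxQ_of_mem (Q : S → A → ℝ) {s : S} (hs : s ∈ M.goal) : M.maxQ Q s = M.reward s :=
  dif_neg (by simp [M.act_goal s hs])

theorem le_maxQ (Q : S → A → ℝ) {s : S} {a : A} (ha : a ∈ M.act s) : Q s a ≤ M.maxQ Q s := by
  rw [maxQ, dif_pos ⟨a, ha⟩]
  exact Finset.le_sup' (Q s) ha

theorem exists_maxQ_eq (Q : S → A → ℝ) {s : S} (hs : s ∉ M.goal) :
    ∃ a ∈ M.act s, M.maxQ Q s = Q s a := by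
  rw [maxQ, dif_pos (M.act_nonempty s hs)]
  exact Finset.exists_mem_eq_sup' _ _

theorem abs_maxQ_sub_le {Q Q' : S → A → ℝ} {s : S} {d : ℝ} (hd : 0 ≤ d)
    (h : ∀ a ∈ M.act s, |Q s a - Q' s a| ≤ d) : |M.maxQ Q s - M.maxQ Q' s| ≤ d := by
  by_cases hs : s ∈ M.goal
  · rw [maxQ_of_mem Q hs, maxQ_of_mem Q' hs]
    simpa
  · obtain ⟨a, ha, hQ⟩ := exists_maxQ_eq Q hs
    obtain ⟨b, hb, hQ'⟩ := exists_maxQ_eq Q' hs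
    have h1 := (abs_le.1 (h a ha)).2
    have h2 := (abs_le.1 (h b hb)).1
    have h3 := le_maxQ Q hb
    have h4 := le_maxQ Q' ha
    rw [abs_le]
    constructor <;> linarith

variable (M) in
/-- The qualities for the value function `V`. -/
noncomputable def qExact (V : S → ℝ) (s : S) (a : A) : ℝ :=
  M.reward s + ∑ s', V s' * M.trans s a s'

open scoped Classical in
theorem Weight.exists_solvesBellman (w : M.Weight) : ∃ V, M.SolvesBellman V := by
  have hw : ∀ s, 0 < w.w s := fun s => one_pos.trans_le (w.one_le s)
  let G : (S → ℝ) → S → ℝ := fun x s =>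
    if M.Reachable s then M.maxQ (M.qExact fun s' => w.w s' * x s') s / w.w s else 0
  have hG : ContractingWith ⟨w.β, w.β_pos.le⟩ G := by
    refine ⟨w.β_lt_one, LipschitzWith.of_dist_le_mul fun x y => ?_⟩
    have hd : 0 ≤ w.β * dist x y := mul_nonneg w.β_pos.le dist_nonneg
    refine (dist_pi_le_iff hd).2 fun s => ?_
    by_cases hs : M.Reachable s
    · simp only [G, if_pos hs]
      rw [Real.dist_eq, ← sub_div, abs_div, abs_of_pos (hw s), div_le_iff₀ (hw s)]
      refine abs_maxQ_sub_le (mul_nonneg hd (hw s).le) fun a ha => ?_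
      have h1 : M.qExact (fun s' => w.w s' * x s') s a - M.qExact (fun s' => w.w s' * y s') s a =
          ∑ s', M.trans s a s' * w.w s' * (x s' - y s') := by
        simp only [qExact]
        rw [add_sub_add_left_eq_sub, ← Finset.sum_sub_distrib]
        exact Finset.sum_congr rfl fun _ _ => by ring
      rw [h1]
      calc _ ≤ ∑ s', |M.trans s a s' * w.w s' * (x s' - y s')| := Finset.abs_sum_le_sum_abs _ _
        _ ≤ ∑ s', M.trans s a s' * w.w s' * dist x y := by
          refine Finset.sum_le_sum fun s' _ => ?_
          have h2 : 0 ≤ M.trans s a s' * w.w s' := mul_nonneg (M.trans_nonneg _ _ _) (hw s').le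
          rw [abs_mul, abs_of_nonneg h2, ← Real.dist_eq]
          exact mul_le_mul_of_nonneg_left (dist_le_pi_dist x y s') h2
        _ = (∑ s', M.trans s a s' * w.w s') * dist x y := by rw [Finset.sum_mul]
        _ ≤ w.β * w.w s * dist x y := mul_le_mul_of_nonneg_right
          (w.sum_le s hs (M.notMem_goal_of_mem_act ha) a ha) dist_nonneg
        _ = _ := by ring
    · simp only [G, if_neg hs, dist_self]
      exact hd
  obtain ⟨x, hx⟩ : ∃ x, G x = x := ⟨_, hG.fixedPoint_isFixedPt⟩
  refine ⟨fun s => w.w s * x s, fun s hs => ?_⟩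
  have h1 : x s = M.maxQ (M.qExact fun s' => w.w s' * x s') s / w.w s :=
    (congrFun hx s).symm.trans (if_pos hs)
  rw [eq_div_iff (hw s).ne', mul_comm] at h1
  exact h1

theorem SolvesBellman.eq_reward {V : S → ℝ} (hV : M.SolvesBellman V) {s : S} (hs : M.Reachable s)
    (hg : s ∈ M.goal) : V s = M.reward s := by
  rw [hV s hs, maxQ_of_mem _ hg]

theorem SolvesBellman.qExact_le {V : S → ℝ} (hV : M.SolvesBellman V) {s : S} (hs : M.Reachable s)
    {a : A} (ha : a ∈ M.act s) : M.qExact V s a ≤ V s := by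
  rw [hV s hs]
  exact le_maxQ (M.qExact V) ha

theorem SolvesBellman.le (w : M.Weight) {V W : S → ℝ} (hV : M.SolvesBellman V)
    (hW : M.SolvesBellman W) {s : S} (hs : M.Reachable s) : V s ≤ W s := by
  refine sub_nonpos.1 (w.nonpos_of_subharmonic (D := fun s => V s - W s) ?_ ?_ hs)
  · intro s hg hs
    rw [hV.eq_reward hs hg, hW.eq_reward hs hg, sub_self]
  · intro s hg hs
    obtain ⟨a, ha, hQ⟩ := exists_maxQ_eq (M.qExact V) hg
    refine ⟨a, ha, ?_⟩
    have h1 : V s = M.qExact V s a := (hV s hs).trans hQ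
    have h2 := hW.qExact_le hs ha
    calc V s - W s ≤ M.qExact V s a - M.qExact W s a := by linarith
      _ = _ := by
        simp only [qExact]
        rw [add_sub_add_left_eq_sub, ← Finset.sum_sub_distrib]
        exact Finset.sum_congr rfl fun _ _ => by ring

/-! ### Expected rewards -/

theorem Strategy.exists_act_sum_le (σ : M.Strategy) {s : S} (hs : s ∉ M.goal) (q : A → ℝ) :
    ∃ a ∈ M.act s, ∑ b, σ.prob s b * q b ≤ q a := by
  obtain ⟨a, ha, hmax⟩ := (M.act s).exists_max_image q (M.act_nonempty s hs)
  refine ⟨a, ha, ?_⟩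
  rw [← one_mul (q a), ← σ.sum_eq_one s hs, Finset.sum_mul]
  refine Finset.sum_le_sum fun b _ => ?_
  by_cases hb : b ∈ M.act s
  · exact mul_le_mul_of_nonneg_left (hmax b hb) (σ.nonneg s b)
  · simp [σ.disabled s b hb]

theorem Strategy.exists_act_sum_trans_le (σ : M.Strategy) {s : S} (hs : s ∉ M.goal) (D : S → ℝ) :
    ∃ a ∈ M.act s, ∑ x : A × S, σ.prob s x.1 * M.trans s x.1 x.2 * D x.2 ≤
      ∑ s', M.trans s a s' * D s' := by
  obtain ⟨a, ha, h⟩ := σ.exists_act_sum_le hs fun a => ∑ s', M.trans s a s' * D s'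
  refine ⟨a, ha, le_of_eq_of_le ?_ h⟩
  rw [Fintype.sum_prod_type]
  refine Finset.sum_congr rfl fun b _ => ?_
  rw [Finset.mul_sum]
  exact Finset.sum_congr rfl fun _ _ => by ring

theorem Weight.reachProb_eq_one (w : M.Weight) (σ : M.Strategy) {s : S} (hs : M.Reachable s) :
    M.reachProb σ s = 1 := by
  refine le_antisymm (M.reachProb_le_one σ s) (sub_nonpos.1
    (w.nonpos_of_subharmonic (D := fun s => 1 - M.reachProb σ s) ?_ ?_ hs))
  · intro s hg _
    rw [M.reachProb_of_mem σ hg, sub_self]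
  · intro s hg _
    obtain ⟨a, ha, h⟩ := σ.exists_act_sum_trans_le hg fun s => 1 - M.reachProb σ s
    refine ⟨a, ha, le_of_eq_of_le ?_ h⟩
    simp only [mul_sub, Finset.sum_sub_distrib, mul_one]
    rw [M.sum_prob_mul_trans σ hg, M.reachProb_of_notMem σ hg]

theorem exists_abs_runReward_le (M : MDP S A) : ∃ C, 0 ≤ C ∧ ∀ s (π : List (A × S)),
    |M.runReward s π| ≤ C * (π.length + 1) := by
  refine ⟨∑ s, |M.reward s|, Finset.sum_nonneg fun _ _ => abs_nonneg _, fun s π => ?_⟩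
  have hle : ∀ s, |M.reward s| ≤ ∑ s, |M.reward s| := fun s =>
    Finset.single_le_sum (f := fun s => |M.reward s|) (fun _ _ => abs_nonneg _) (Finset.mem_univ s)
  induction π generalizing s with
  | nil => simpa [runReward] using hle s
  | cons x π ih =>
    simp only [runReward]
    refine (abs_add_le _ _).trans ((add_le_add (hle s) (ih x.2)).trans (le_of_eq ?_))
    rw [List.length_cons]
    push_cast
    ring

theorem Weight.summable_goalProb_mul_runReward (w : M.Weight) (σ : M.Strategy) {s : S}
    (hs : M.Reachable s) : Summable fun π => M.goalProb σ s π * M.runReward s π := by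
  have hβ := w.β_pos
  have hw : ∀ s, 0 < w.w s := fun s => one_pos.trans_le (w.one_le s)
  have hsum : Summable fun π => M.goalProb σ s π * (1 / w.β) ^ π.length := by
    refine summable_of_sum_le (c := w.w s) (fun π => mul_nonneg (M.goalProb_nonneg σ s π)
      (by positivity)) fun F => ?_
    refine M.sum_goalProb_le σ (by positivity) (D := M.Reachable) (fun s a s' h ht => h.step ht)
      (fun s => (hw s).le) (fun s _ => w.one_le s) (fun s hg hs => ?_) s hs F
    obtain ⟨a, ha, h⟩ := σ.exists_act_sum_trans_le hg fun s => 1 / w.β * w.w s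
    refine h.trans ?_
    have h1 := w.sum_le s hs hg a ha
    calc ∑ s', M.trans s a s' * (1 / w.β * w.w s') = 1 / w.β * ∑ s', M.trans s a s' * w.w s' := by
          rw [Finset.mul_sum]
          exact Finset.sum_congr rfl fun _ _ => by ring
      _ ≤ 1 / w.β * (w.β * w.w s) := mul_le_mul_of_nonneg_left h1 (by positivity)
      _ = w.w s := by field_simp
  obtain ⟨C, hC, hrew⟩ := M.exists_abs_runReward_le
  set c := 1 / w.β - 1 with hc
  have hc0 : 0 < c := by
    rw [hc, sub_pos, lt_div_iff₀ hβ, one_mul]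
    exact w.β_lt_one
  refine (hsum.mul_left (C * (1 + 1 / c))).of_norm_bounded fun π => ?_
  have hb : 1 + π.length * c ≤ (1 / w.β) ^ π.length := by
    have := one_add_mul_le_pow (a := c) (by linarith) π.length
    rwa [hc, add_sub_cancel, ← hc] at this
  have hlen : (π.length : ℝ) + 1 ≤ (1 + 1 / c) * (1 / w.β) ^ π.length := by
    have h0 : (0 : ℝ) ≤ π.length := Nat.cast_nonneg _
    refine le_trans ?_ (mul_le_mul_of_nonneg_left hb (by positivity))
    have : (1 + 1 / c) * (1 + π.length * c) = 1 + π.length + π.length * c + 1 / c := by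
      field_simp
      ring
    rw [this]
    have h1 : 0 ≤ π.length * c := by positivity
    have h2 : 0 < 1 / c := by positivity
    linarith
  have hg := M.goalProb_nonneg σ s π
  rw [Real.norm_eq_abs, abs_mul, abs_of_nonneg hg]
  calc _ ≤ M.goalProb σ s π * (C * ((1 + 1 / c) * (1 / w.β) ^ π.length)) :=
        mul_le_mul_of_nonneg_left ((hrew s π).trans (mul_le_mul_of_nonneg_left hlen hC)) hg
    _ = _ := by ring

variable (M) in
/-- The expected accumulated reward until the goal. -/
noncomputable def expReward (σ : M.Strategy) (s : S) : ℝ :=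
  ∑' π, M.goalProb σ s π * M.runReward s π

theorem Weight.hasExpectedReward (w : M.Weight) (σ : M.Strategy) {s : S} (hs : M.Reachable s) :
    M.HasExpectedReward σ s (M.expReward σ s) := (w.summable_goalProb_mul_runReward σ hs).hasSum

theorem expReward_of_mem (σ : M.Strategy) {s : S} (hg : s ∈ M.goal) :
    M.expReward σ s = M.reward s := by
  have h := hasSum_list_of_cons (f := fun π => M.goalProb σ s π * M.runReward s π)
    (b := fun _ => 0) fun x => by
    simp only [M.goalProb_cons_of_mem σ hg, zero_mul]
    exact hasSum_zero
  rw [expReward, h.tsum_eq, M.goalProb_nil_of_mem σ hg]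
  simp [runReward]

theorem Weight.expReward_of_notMem (w : M.Weight) (σ : M.Strategy) {s : S} (hs : M.Reachable s)
    (hg : s ∉ M.goal) : M.expReward σ s = M.reward s +
      ∑ x : A × S, σ.prob s x.1 * M.trans s x.1 x.2 * M.expReward σ x.2 := by
  have h := hasSum_list_of_cons (f := fun π => M.goalProb σ s π * M.runReward s π)
    (b := fun x => σ.prob s x.1 * M.trans s x.1 x.2 * (M.reward s + M.expReward σ x.2)) fun x => by
    rcases (M.trans_nonneg s x.1 x.2).eq_or_lt with ht | ht
    · simp only [M.goalProb_cons_of_notMem σ hg, ← ht, mul_zero, zero_mul]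
      exact hasSum_zero
    · have hx := hs.step ht
      have h1 := M.hasSum_reachProb σ x.2
      rw [w.reachProb_eq_one σ hx] at h1
      have h2 := ((h1.mul_right (M.reward s)).add (w.hasExpectedReward σ hx)).mul_left
        (σ.prob s x.1 * M.trans s x.1 x.2)
      rw [one_mul] at h2
      refine h2.congr_fun fun π => ?_
      rw [M.goalProb_cons_of_notMem σ hg]
      simp only [runReward]
      ring
  rw [expReward, h.tsum_eq, M.goalProb_nil_of_notMem σ hg, zero_mul, zero_add]
  simp only [mul_add, Finset.sum_add_distrib]
  rw [← Finset.sum_mul, M.sum_prob_mul_trans σ hg, one_mul]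

theorem Strategy.sum_prob_mul_qExact (σ : M.Strategy) {s : S} (hg : s ∉ M.goal) (V : S → ℝ) :
    ∑ a, σ.prob s a * M.qExact V s a =
      M.reward s + ∑ x : A × S, σ.prob s x.1 * M.trans s x.1 x.2 * V x.2 := by
  simp only [qExact, mul_add, Finset.sum_add_distrib]
  rw [← Finset.sum_mul, σ.sum_eq_one s hg, one_mul, Fintype.sum_prod_type]
  congr 1
  refine Finset.sum_congr rfl fun b _ => ?_
  rw [Finset.mul_sum]
  exact Finset.sum_congr rfl fun _ _ => by ring

theorem SolvesBellman.expReward_le {V : S → ℝ} (hV : M.SolvesBellman V) (w : M.Weight)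
    (σ : M.Strategy) {s : S} (hs : M.Reachable s) : M.expReward σ s ≤ V s := by
  refine sub_nonpos.1 (w.nonpos_of_subharmonic (D := fun s => M.expReward σ s - V s) ?_ ?_ hs)
  · intro s hg hs
    rw [hV.eq_reward hs hg, expReward_of_mem σ hg, sub_self]
  · intro s hg hs
    obtain ⟨a, ha, h⟩ := σ.exists_act_sum_trans_le hg fun s => M.expReward σ s - V s
    refine ⟨a, ha, le_trans ?_ h⟩
    have h1 : ∑ a, σ.prob s a * M.qExact V s a ≤ V s := by
      obtain ⟨b, hb, h⟩ := σ.exists_act_sum_le hg (M.qExact V s)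
      exact h.trans (hV.qExact_le hs hb)
    rw [σ.sum_prob_mul_qExact hg] at h1
    simp only [mul_sub, Finset.sum_sub_distrib]
    rw [w.expReward_of_notMem σ hs hg]
    linarith

/-- A strategy that chooses actions of maximal exact quality is optimal. -/
theorem SolvesBellman.optimal {V : S → ℝ} (hV : M.SolvesBellman V) (w : M.Weight) {σ : M.Strategy}
    (hσ : ∀ s, M.Reachable s → s ∉ M.goal → ∀ a, 0 < σ.prob s a → a ∈ M.argmax (M.qExact V) s)
    {s : S} (hs : M.Reachable s) : M.HasExpectedReward σ s (V s) ∧ M.IsOptimalAt σ s := by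
  have h1 : V s ≤ M.expReward σ s := by
    refine sub_nonpos.1 (w.nonpos_of_subharmonic (D := fun s => V s - M.expReward σ s) ?_ ?_ hs)
    · intro s hg hs
      rw [hV.eq_reward hs hg, expReward_of_mem σ hg, sub_self]
    · intro s hg hs
      obtain ⟨a, ha, h⟩ := σ.exists_act_sum_trans_le hg fun s => V s - M.expReward σ s
      refine ⟨a, ha, le_trans ?_ h⟩
      have h2 : ∑ a, σ.prob s a * M.qExact V s a = V s := by
        rw [← one_mul (V s), ← σ.sum_eq_one s hg, Finset.sum_mul]
        refine Finset.sum_congr rfl fun b _ => ?_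
        rcases (σ.nonneg s b).eq_or_lt with h0 | h0
        · simp [← h0]
        · obtain ⟨hb, hmax⟩ := Finset.mem_filter.1 (hσ s hs hg b h0)
          obtain ⟨c, hc, hQ⟩ := exists_maxQ_eq (M.qExact V) hg
          have h3 : V s = M.qExact V s c := (hV s hs).trans hQ
          rw [le_antisymm (hV.qExact_le hs hb) (h3 ▸ hmax c hc)]
      rw [σ.sum_prob_mul_qExact hg] at h2
      simp only [mul_sub, Finset.sum_sub_distrib]
      rw [w.expReward_of_notMem σ hs hg]
      linarith
  have h2 : M.HasExpectedReward σ s (V s) := by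
    rw [le_antisymm h1 (hV.expReward_le w σ hs)]
    exact w.hasExpectedReward σ hs
  refine ⟨h2, V s, h2, fun σ' v' hv' => ?_⟩
  rw [hv'.unique (w.hasExpectedReward σ' hs)]
  exact hV.expReward_le w σ' hs

end MDP

/-! ### Interval value iteration -/

section GreedyFill

variable {S : Type u} [Fintype S] [DecidableEq S]

theorem le_greedyFill (l h : S → ℝ) (order : List S) (s : S) : l s ≤ greedyFill l h order s := by
  unfold greedyFill
  induction order generalizing l with
  | nil => exact le_rfl
  | cons x order ih =>
    refine le_trans ?_ (ih _)
    beta_reduce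
    by_cases hx : s = x
    · subst hx
      rw [Function.update_self]
      exact le_max_left _ _
    · rw [Function.update_of_ne hx]

theorem greedyFill_le (l h : S → ℝ) (order : List S) (s : S) :
    greedyFill l h order s ≤ max (l s) (h s) := by
  unfold greedyFill
  induction order generalizing l with
  | nil => exact le_max_left _ _
  | cons x order ih =>
    refine (ih _).trans (max_le ?_ (le_max_right _ _))
    beta_reduce
    by_cases hx : s = x
    · subst hx
      rw [Function.update_self]
      exact max_le_max le_rfl (min_le_left _ _)
    · rw [Function.update_of_ne hx]
      exact le_max_left _ _

theorem abs_greedyFill_sub_le (l h : S → ℝ) (order : List S) (s : S) (c : ℝ) :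
    |greedyFill l h order s - c| ≤ |l s - c| + |h s - c| := by
  have h1 := le_greedyFill l h order s
  have h2 := greedyFill_le l h order s
  have h3 := abs_le.1 (le_refl |l s - c|)
  have h4 := abs_le.1 (le_refl |h s - c|)
  have h5 := abs_nonneg (l s - c)
  have h6 := abs_nonneg (h s - c)
  rw [abs_le]
  rcases le_max_iff.1 h2 with h2 | h2 <;> constructor <;> linarith

end GreedyFill

namespace MDP

open Filter

variable {S : Type u} {A : Type v} [Fintype S] [Fintype A] [DecidableEq S] [DecidableEq A]
  {M : MDP S A}

/-- Quality for transitions that may depend on the value function. -/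
noncomputable def qOf (M : MDP S A) (t : (S → ℝ) → S → A → S → ℝ) (V : S → ℝ) (s : S) (a : A) : ℝ :=
  M.reward s + ∑ s', V s' * t V s a s'

/-- The transitions `t` approximate those of the MDP up to `η` in the reachable part. -/
structure Approximates (M : MDP S A) (t : (S → ℝ) → S → A → S → ℝ) (η : ℝ) : Prop where
  abs_sub_le : ∀ V s, M.Reachable s → ∀ a ∈ M.act s, ∀ s', |t V s a s' - M.trans s a s'| ≤ η
  eq_zero : ∀ V s a s', s' ∉ M.post s a → t V s a s' = 0

theorem Approximates.abs_qOf_sub_le {t : (S → ℝ) → S → A → S → ℝ} {η : ℝ}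
    (ht : M.Approximates t η) (hη : 0 ≤ η) (w : M.Weight) {V V' : S → ℝ} {B C : ℝ} (hB : 0 ≤ B)
    (hV : ∀ s, M.Reachable s → |V s - V' s| ≤ B * w.w s) (hC : ∀ s, |V' s| ≤ C) {s : S}
    (hs : M.Reachable s) {a : A} (ha : a ∈ M.act s) :
    |M.qOf t V s a - M.qExact V' s a| ≤
      ((w.β + 2 * η * Fintype.card S) * B + Fintype.card S * η * C) * w.w s := by
  have hw1 := w.one_le s
  have h1 : M.qOf t V s a - M.qExact V' s a =
      ∑ s', (t V s a s' * (V s' - V' s') + (t V s a s' - M.trans s a s') * V' s') := by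
    simp only [qOf, qExact]
    rw [add_sub_add_left_eq_sub, ← Finset.sum_sub_distrib]
    exact Finset.sum_congr rfl fun _ _ => by ring
  have h2 : ∀ s', |t V s a s' * (V s' - V' s') + (t V s a s' - M.trans s a s') * V' s'| ≤
      B * (M.trans s a s' * w.w s') + 2 * η * B + η * C := by
    intro s'
    have hd := ht.abs_sub_le V s hs a ha s'
    have hT := M.trans_nonneg s a s'
    refine (abs_add_le _ _).trans (add_le_add ?_ ?_)
    · rw [abs_mul]
      by_cases hp : s' ∈ M.post s a
      · have hr := hV s' (hs.step (M.mem_post.1 hp))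
        have habs : |t V s a s'| ≤ M.trans s a s' + η := by
          have h := abs_add_le (t V s a s' - M.trans s a s') (M.trans s a s')
          rw [sub_add_cancel, abs_of_nonneg hT] at h
          linarith
        have hw0 := w.one_le s'
        have hw2 := w.le_two s'
        calc |t V s a s'| * |V s' - V' s'|
            ≤ (M.trans s a s' + η) * (B * w.w s') :=
              mul_le_mul habs hr (abs_nonneg _) (by linarith)
          _ = B * (M.trans s a s' * w.w s') + η * B * w.w s' := by ring
          _ ≤ B * (M.trans s a s' * w.w s') + η * B * 2 := by gcongr
          _ = _ := by ring
      · rw [ht.eq_zero V s a s' hp, M.trans_eq_zero hp]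
        simp only [abs_zero, zero_mul, mul_zero, zero_add]
        positivity
    · rw [abs_mul]
      exact mul_le_mul hd (hC s') (abs_nonneg _) hη
  have hC0 : 0 ≤ C := (abs_nonneg _).trans (hC s)
  rw [h1]
  refine (Finset.abs_sum_le_sum_abs _ _).trans ((Finset.sum_le_sum fun s' _ => h2 s').trans ?_)
  rw [Finset.sum_add_distrib, Finset.sum_add_distrib, ← Finset.mul_sum, Finset.sum_const,
    Finset.sum_const, nsmul_eq_mul, nsmul_eq_mul, Finset.card_univ]
  have h3 := mul_le_mul_of_nonneg_left
    (w.sum_le s hs (M.notMem_goal_of_mem_act ha) a ha) hB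
  have h4 : (0 : ℝ) ≤ Fintype.card S * (2 * η * B) + Fintype.card S * (η * C) := by positivity
  have h5 := le_mul_of_one_le_right h4 hw1
  nlinarith

theorem Approximates.abs_iterate_sub_le {t : (S → ℝ) → S → A → S → ℝ} {η : ℝ}
    (ht : M.Approximates t η) (hη : 0 ≤ η) (w : M.Weight) {V : S → ℝ} (hV : M.SolvesBellman V)
    {V₀ : S → ℝ} {B C g : ℝ} (hB : 0 ≤ B) (h0 : ∀ s, M.Reachable s → |V₀ s - V s| ≤ B * w.w s)
    (hC : ∀ s, |V s| ≤ C) (hg : w.β + 2 * η * Fintype.card S ≤ g) (hg1 : g < 1) (n : ℕ) {s : S}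
    (hs : M.Reachable s) :
    |(fun W => M.maxQ (M.qOf t W))^[n] V₀ s - V s| ≤
      (g ^ n * B + Fintype.card S * η * C / (1 - g)) * w.w s := by
  have hC0 : 0 ≤ C := (abs_nonneg _).trans (hC s)
  have hg0 : 0 ≤ g := le_trans (add_nonneg w.β_pos.le (by positivity)) hg
  have h1g : 0 < 1 - g := by linarith
  have hD : 0 ≤ Fintype.card S * η * C / (1 - g) := by positivity
  induction n generalizing s with
  | zero =>
    have := w.one_le s
    refine (h0 s hs).trans ?_
    rw [pow_zero, one_mul]
    gcongr
    linarith
  | succ n ih =>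
    rw [Function.iterate_succ_apply', hV s hs]
    have hw := w.one_le s
    set D := Fintype.card S * η * C / (1 - g) with hDdef
    have hDeq : Fintype.card S * η * C = D * (1 - g) := by
      rw [hDdef, div_mul_cancel₀ _ h1g.ne']
    have hBn : 0 ≤ g ^ n * B + D := by positivity
    refine abs_maxQ_sub_le (by positivity) fun a ha => ?_
    refine (ht.abs_qOf_sub_le hη w hBn (fun s hs => ih hs) hC hs ha).trans ?_
    refine mul_le_mul_of_nonneg_right ?_ (by linarith)
    rw [hDeq]
    have := mul_le_mul_of_nonneg_right hg hBn
    rw [pow_succ]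
    nlinarith

/-- Value iteration with converging transitions converges to the optimal values. -/
theorem tendsto_iterate_of_approximates (w : M.Weight) {V : S → ℝ} (hV : M.SolvesBellman V)
    {t : ℕ → (S → ℝ) → S → A → S → ℝ} {η : ℕ → ℝ} (hη : ∀ k, 0 ≤ η k)
    (ht : ∀ k, M.Approximates (t k) (η k)) (hlim : Tendsto η atTop (nhds 0)) (V₀ : S → ℝ)
    {n : ℕ → ℕ} (hn : Tendsto n atTop atTop) {s : S} (hs : M.Reachable s) :
    Tendsto (fun k => (fun W => M.maxQ (M.qOf (t k) W))^[n k] V₀ s) atTop (nhds (V s)) := by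
  set C := ∑ s, |V s|
  have hC : ∀ s, |V s| ≤ C := fun s =>
    Finset.single_le_sum (f := fun s => |V s|) (fun _ _ => abs_nonneg _) (Finset.mem_univ s)
  set B := ∑ s, |V₀ s - V s|
  have hB : 0 ≤ B := Finset.sum_nonneg fun _ _ => abs_nonneg _
  have h0 : ∀ s, M.Reachable s → |V₀ s - V s| ≤ B * w.w s := fun s _ =>
    (Finset.single_le_sum (f := fun s => |V₀ s - V s|) (fun _ _ => abs_nonneg _)
      (Finset.mem_univ s)).trans (le_mul_of_one_le_right hB (w.one_le s))
  set g := (w.β + 1) / 2 with hgdef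
  have hβ := w.β_lt_one
  have hβ0 := w.β_pos
  have hg1 : g < 1 := by linarith
  have hg0 : 0 ≤ g := by linarith
  have hev : ∀ᶠ k in atTop, w.β + 2 * η k * Fintype.card S ≤ g := by
    have h1 : Tendsto (fun k => w.β + 2 * η k * Fintype.card S) atTop
        (nhds (w.β + 2 * 0 * Fintype.card S)) :=
      ((hlim.const_mul 2).mul_const _).const_add _
    refine h1.eventually_le_const ?_
    rw [mul_zero, zero_mul, add_zero]
    linarith
  have hbound : Tendsto (fun k => (g ^ n k * B + Fintype.card S * η k * C / (1 - g)) * w.w s) atTop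
      (nhds ((0 * B + Fintype.card S * 0 * C / (1 - g)) * w.w s)) := by
    refine Tendsto.mul_const _ (Tendsto.add ?_ ?_)
    · exact ((tendsto_pow_atTop_nhds_zero_of_lt_one hg0 hg1).comp hn).mul_const B
    · exact ((hlim.const_mul _).mul_const C).div_const _
  rw [show (0 * B + Fintype.card S * 0 * C / (1 - g)) * w.w s = 0 by simp] at hbound
  rw [tendsto_iff_dist_tendsto_zero]
  refine squeeze_zero' (Eventually.of_forall fun _ => dist_nonneg) ?_ hbound
  filter_upwards [hev] with k hk
  exact (ht k).abs_iterate_sub_le (hη k) w hV hB h0 hC hk hg1 (n k) hs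

theorem tendsto_qOf_of_approximates {V : S → ℝ}
    {t : ℕ → (S → ℝ) → S → A → S → ℝ} {η : ℕ → ℝ}
    (ht : ∀ k, M.Approximates (t k) (η k)) (hlim : Tendsto η atTop (nhds 0))
    {W : ℕ → S → ℝ} (hW : ∀ s, M.Reachable s → Tendsto (fun k => W k s) atTop (nhds (V s)))
    {s : S} (hs : M.Reachable s) {a : A} (ha : a ∈ M.act s) :
    Tendsto (fun k => M.qOf (t k) (W k) s a) atTop (nhds (M.qExact V s a)) := by
  refine Tendsto.const_add _ (tendsto_finsetSum _ fun s' _ => ?_)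
  by_cases hp : s' ∈ M.post s a
  · refine (hW s' (hs.step (M.mem_post.1 hp))).mul ?_
    rw [tendsto_iff_dist_tendsto_zero]
    exact squeeze_zero (fun _ => dist_nonneg)
      (fun k => (ht k).abs_sub_le (W k) s hs a ha s') hlim
  · simp only [(ht _).eq_zero _ s a s' hp, M.trans_eq_zero hp, mul_zero]
    exact tendsto_const_nhds

/-- Actions that are eventually maximal for converging qualities are maximal in the limit. -/
theorem eventually_argmax_subset {Q : S → A → ℝ} {q : ℕ → S → A → ℝ}
    (h : ∀ s, M.Reachable s → ∀ a ∈ M.act s, Tendsto (fun k => q k s a) atTop (nhds (Q s a))) :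
    ∀ᶠ k in atTop, ∀ s, M.Reachable s → M.argmax (q k) s ⊆ M.argmax Q s := by
  refine eventually_all.2 fun s => ?_
  by_cases hs : M.Reachable s
  swap
  · exact Eventually.of_forall fun _ h' => absurd h' hs
  have h1 : ∀ a : A, ∀ b : A, ∀ᶠ k in atTop, a ∈ M.act s → b ∈ M.act s → Q s a < Q s b →
      q k s a < q k s b := by
    intro a b
    by_cases hc : a ∈ M.act s ∧ b ∈ M.act s ∧ Q s a < Q s b
    · exact ((h s hs a hc.1).eventually_lt (h s hs b hc.2.1) hc.2.2).mono fun _ h _ _ _ => h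
    · exact Eventually.of_forall fun _ h1 h2 h3 => absurd ⟨h1, h2, h3⟩ hc
  filter_upwards [eventually_all.2 fun a => eventually_all.2 (h1 a)] with k hk _ a ha
  obtain ⟨ha, hmax⟩ := Finset.mem_filter.1 ha
  refine Finset.mem_filter.2 ⟨ha, fun b hb => ?_⟩
  by_contra! hlt
  exact absurd (hk a b ha hb hlt) (not_lt.2 (hmax b hb))

theorem exists_approximates {U : ℕ → IntervalTrans S A}
    (hlo : ∀ s, M.Reachable s → ∀ a ∈ M.act s, ∀ s',
      Tendsto (fun k => (U k).lo s a s') atTop (nhds (M.trans s a s')))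
    (hhi : ∀ s, M.Reachable s → ∀ a ∈ M.act s, ∀ s',
      Tendsto (fun k => (U k).hi s a s') atTop (nhds (M.trans s a s')))
    (hlo0 : ∀ k s a s', s' ∉ M.post s a → (U k).lo s a s' = 0)
    (hhi0 : ∀ k s a s', s' ∉ M.post s a → (U k).hi s a s' = 0) :
    ∃ η : ℕ → ℝ, (∀ k, 0 ≤ η k) ∧ Tendsto η atTop (nhds 0) ∧
      ∀ k, ∀ order : (S → ℝ) → List S,
        M.Approximates (fun V s a => greedyFill ((U k).lo s a) ((U k).hi s a) (order V)) (η k) := by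
  classical
  let e : ℕ → S × A × S → ℝ := fun k x =>
    if M.Reachable x.1 ∧ x.2.1 ∈ M.act x.1 then
      |(U k).lo x.1 x.2.1 x.2.2 - M.trans x.1 x.2.1 x.2.2| +
        |(U k).hi x.1 x.2.1 x.2.2 - M.trans x.1 x.2.1 x.2.2| else 0
  have he : ∀ k x, 0 ≤ e k x := fun k x => by
    simp only [e]
    split_ifs <;> positivity
  refine ⟨fun k => ∑ x, e k x, fun k => Finset.sum_nonneg fun x _ => he k x, ?_, fun k order =>
    ⟨fun V s hs a ha s' => ?_, fun V s a s' hs' => ?_⟩⟩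
  · rw [← Finset.sum_const_zero (s := (Finset.univ : Finset (S × A × S)))]
    refine tendsto_finsetSum _ fun x _ => ?_
    by_cases hx : M.Reachable x.1 ∧ x.2.1 ∈ M.act x.1
    · simp only [e, if_pos hx]
      have h1 := ((hlo x.1 hx.1 x.2.1 hx.2 x.2.2).sub_const (M.trans x.1 x.2.1 x.2.2)).abs
      have h2 := ((hhi x.1 hx.1 x.2.1 hx.2 x.2.2).sub_const (M.trans x.1 x.2.1 x.2.2)).abs
      simpa using h1.add h2
    · simp only [e, if_neg hx]
      exact tendsto_const_nhds
  · refine (abs_greedyFill_sub_le _ _ _ _ _).trans ?_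
    have h1 := Finset.single_le_sum (fun x _ => he k x) (Finset.mem_univ (s, a, s'))
    simp only [e] at h1
    rwa [if_pos ⟨hs, ha⟩] at h1
  · refine le_antisymm ((greedyFill_le _ _ _ _).trans ?_) (le_trans ?_ (le_greedyFill _ _ _ _))
    · rw [hlo0 k s a s' hs', hhi0 k s a s' hs', max_self]
    · rw [hlo0 k s a s' hs']

end MDP

namespace RLParams

open MeasureTheory Filter

variable {S : Type u} {A : Type v} [Fintype S] [Fintype A] [DecidableEq S] [DecidableEq A]
  {M : MDP S A}

theorem tendsto_mul_epLen (P : RLParams M) : Tendsto (fun k => k * P.epLen) atTop atTop :=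
  tendsto_id.atTop_mul_const' P.epLen_pos

theorem ae_tendsto_intervals (P : RLParams M)
    (hε : ¬ Summable fun k => P.ε k ^ Fintype.card S) :
    ∀ᵐ ω ∂P.law, ∀ s, M.Reachable s → ∀ a ∈ M.act s, ∀ s',
      Tendsto (fun k => (P.intervals (P.history ω k)).lo s a s') atTop (nhds (M.trans s a s')) ∧
      Tendsto (fun k => (P.intervals (P.history ω k)).hi s a s') atTop (nhds (M.trans s a s')) := by
  rw [ae_all_iff]; intro s
  refine eventually_imp_distrib_left.2 fun hs => ?_
  rw [ae_all_iff]; intro a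
  refine eventually_imp_distrib_left.2 fun ha => ?_
  rw [ae_all_iff]; intro s'
  by_cases hs' : s' ∈ M.post s a
  swap
  · refine Eventually.of_forall fun ω => ?_
    simp only [intervals, hs', not_false_eq_true, if_true, M.trans_eq_zero hs']
    exact ⟨tendsto_const_nhds, tendsto_const_nhds⟩
  filter_upwards [P.ae_tendsto_visits hε ha hs, P.ae_tendsto_frequency hs'] with ω hv hf
  have hv' := hv.comp P.tendsto_mul_epLen
  have hf' := (hf hv).comp P.tendsto_mul_epLen
  have hrad : Tendsto (fun k => P.radius (P.history ω k) s a) atTop (nhds 0) := by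
    have h1 : Tendsto (fun k => Real.log ((P.δ / P.numTrans) / 2) /
        (-2 * (P.visits (P.history ω k) s a : ℝ))) atTop (nhds 0) := by
      refine Tendsto.div_atBot tendsto_const_nhds ?_
      exact (tendsto_natCast_atTop_atTop.comp hv').const_mul_atTop_of_neg (by norm_num)
    have h2 := h1.sqrt
    rw [Real.sqrt_zero] at h2
    exact h2
  have hne : ∀ᶠ k in atTop, P.visits (P.history ω k) s a ≠ 0 := hv'.eventually_ne_atTop 0
  have hT := M.mem_post.1 hs'
  constructor
  · have h1 := (hf'.sub hrad).max (tendsto_const_nhds (x := P.pmin))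
    rw [sub_zero, max_eq_left (P.pmin_le s a s' hT)] at h1
    refine h1.congr' ?_
    filter_upwards [hne] with k hk
    simp only [intervals, hs', not_true_eq_false, if_false, hk]
    rfl
  · have h1 := (hf'.add hrad).min (tendsto_const_nhds (x := (1 : ℝ)))
    rw [add_zero, min_eq_left (M.trans_le_one s a s')] at h1
    refine h1.congr' ?_
    filter_upwards [hne] with k hk
    simp only [intervals, hs', not_true_eq_false, if_false, hk]
    rfl

end RLParams

theorem theorem2 {S : Type u} {A : Type v} [Fintype S] [Fintype A] [DecidableEq S] [DecidableEq A]
    (M : MDP S A) (hM : M.Contracting) (P : RLParams M)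
    (hε : ¬ Summable fun k => P.ε k ^ Fintype.card S) :
    ∃ Vstar : S → ℝ,
      (M.SolvesBellman Vstar ∧
        ∀ W, M.SolvesBellman W → ∀ s, M.Reachable s → W s = Vstar s) ∧
      ∀ᵐ ω ∂P.law,
        (∀ s, M.Reachable s →
          Filter.Tendsto (fun K => P.lowerBound K (P.history ω K) s) Filter.atTop
            (nhds (Vstar s)) ∧
          Filter.Tendsto (fun K => P.upperBound K (P.history ω K) s) Filter.atTop
            (nhds (Vstar s))) ∧
        ∀ᶠ K in Filter.atTop, ∀ σ : M.Strategy,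
          (M.IsGreedy (P.lowerQ K (P.history ω K)) σ ∨
            M.IsGreedy (P.upperQ K (P.history ω K)) σ) →
          ∀ s, M.Reachable s → M.HasExpectedReward σ s (Vstar s) ∧ M.IsOptimalAt σ s := by
  obtain ⟨w⟩ := hM.nonempty_weight P.pmin_pos P.pmin_le
  obtain ⟨V, hV⟩ := w.exists_solvesBellman
  refine ⟨V, ⟨hV, fun W hW s hs => le_antisymm (hW.le w hV hs) (hV.le w hW hs)⟩, ?_⟩
  filter_upwards [P.ae_tendsto_intervals hε] with ω hω
  obtain ⟨η, hη, hlim, happ⟩ := MDP.exists_approximates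
    (U := fun k => P.intervals (P.history ω k))
    (fun s hs a ha s' => (hω s hs a ha s').1) (fun s hs a ha s' => (hω s hs a ha s').2)
    (fun k s a s' h => if_pos h) (fun k s a s' h => if_pos h)
  have hn : Filter.Tendsto (fun K => K * Fintype.card S) Filter.atTop Filter.atTop :=
    Filter.tendsto_id.atTop_mul_const' P.card_pos
  have hmin := fun k => happ k fun V =>
    (Finset.univ : Finset S).toList.mergeSort fun x y => decide (V x ≤ V y)
  have hmax := fun k => happ k fun V =>
    (Finset.univ : Finset S).toList.mergeSort fun x y => decide (V y ≤ V x)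
  have hlo : ∀ s, M.Reachable s → Filter.Tendsto (fun K => P.lowerBound K (P.history ω K) s)
      Filter.atTop (nhds (V s)) := fun s hs =>
    MDP.tendsto_iterate_of_approximates w hV hη hmin hlim P.initLo hn hs
  have hhi : ∀ s, M.Reachable s → Filter.Tendsto (fun K => P.upperBound K (P.history ω K) s)
      Filter.atTop (nhds (V s)) := fun s hs =>
    MDP.tendsto_iterate_of_approximates w hV hη hmax hlim P.initHi hn hs
  refine ⟨fun s hs => ⟨hlo s hs, hhi s hs⟩, ?_⟩
  have hqlo := MDP.eventually_argmax_subset (M := M) (Q := M.qExact V)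
    (q := fun K => P.lowerQ K (P.history ω K)) fun s hs a ha =>
    MDP.tendsto_qOf_of_approximates hmin hlim hlo hs ha
  have hqhi := MDP.eventually_argmax_subset (M := M) (Q := M.qExact V)
    (q := fun K => P.upperQ K (P.history ω K)) fun s hs a ha =>
    MDP.tendsto_qOf_of_approximates hmax hlim hhi hs ha
  filter_upwards [hqlo, hqhi] with K h1 h2 σ hσ s hs
  refine hV.optimal w (fun s hs hg a ha => ?_) hs
  rcases hσ with hσ | hσ
  · exact h1 s hs (hσ s hg a ha)
  · exact h2 s hs (hσ s hg a ha)
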